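/- Let $R_0>1$, $R_c>0$, $R_1=R_0+R_c$. Let $N$ and $N^c$ be independent Poisson processes of rates $R_0$ (free server) and $R_c$ (costly server), with nondecreasing, right-continuous, integer-valued paths started at $0$. For $R>1$ let $\bar r(R)$ be the largest root of $\gamma(r)=r+R(e^{-r}-1)$, and put $\alpha_0=\bar r(R_0)$, $\alpha_1=\bar r(R_1)$. A control policy $\pi$ maps the history $h_t=\{x_s:0\le s\le t\}\cup\{u_s:0\le s<t\}$ to an action $u_t=\pi(h_t)\in\{0,1\}$ ($0$: free server only; $1$: both servers), and the buffer size satisfies $$x_t = D+N_t+\int_0^t u_s\,dN^c_s-t ,$$ where $D$ is the initial buffer size. The file size is infinite, so that the interruption probability is $p^\pi(D)=\mathbb P(\inf\{t\ge 0: x_t\le 0\}<\infty)$; $\pi$ is $(D,\varepsilon)$-feasible if $p^\pi(D)\le\varepsilon$, and its cost is $J^\pi(D,\varepsilon)=\mathbb E\big[\int_0^\infty u_t\,dt\big]$ if $\pi$ is $(D,\varepsilon)$-feasible and $+\infty$ otherwise. The online safe policy $\pi^S$ with threshold $S\in\mathbb R$ is: $u_t=1$ if $t\le\tau_S$ and $u_t=0$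 if $t>\tau_S$, where $\tau_S=\inf\{t\ge0: x_t\ge S\}$. Let $\varepsilon>0$ and $D\in\mathbb R$ satisfy $$\frac1{\alpha_1}\log\frac1\varepsilon\le D\le\frac1{\alpha_0}\log\frac1\varepsilon\qquad\text{and}\qquad e^{-\alpha_1D}<\varepsilon ,$$ and let $$S^*=\frac1{\alpha_0}\log\Big(\frac1{\varepsilon-e^{-\alpha_1D}}\Big).$$ Then, for every $S\in\mathbb R$ and every sample point, $\pi^S$ generates exactly one pair of paths $(x,u)$; $\pi^S$ is $(D,\varepsilon)$-feasible for every $S\ge S^*$; and $$\min_{S\ge S^*}J^{\pi^S}(D,\varepsilon)=J^{\pi^{S^*}}(D,\varepsilon)=\frac1{R_1-1}\big[S^*-D+\xi\big]<\infty\qquad\text{for some }\xi\in[0,1).$$ -/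

import Mathlib

open MeasureTheory ProbabilityTheory
open scoped NNReal ENNReal

/-- A sample path of a counting process: `ℕ`-valued, started at `0`, nondecreasing and
right-continuous. -/
structure CountingPath where
  toFun : ℝ≥0 → ℕ
  zero : toFun 0 = 0
  mono : Monotone toFun
  right_cont : ∀ t, ContinuousWithinAt toFun (Set.Ici t) t

instance : CoeFun CountingPath (fun _ => ℝ≥0 → ℕ) := ⟨CountingPath.toFun⟩

/-- A counting path as a (real-valued) Stieltjes function on the time axis `[0, ∞)`. -/
def CountingPath.stieltjes (n : CountingPath) : StieltjesFunction ℝ≥0 where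
  toFun t := (n t : ℝ)
  mono' _ _ h := Nat.cast_le.2 (n.mono h)
  right_continuous' t :=
    (continuous_of_discreteTopology (f := fun k : ℕ => (k : ℝ))).continuousAt.comp_continuousWithinAt
      (n.right_cont t)

/-- `N` is a (homogeneous) Poisson process of rate `R` on `(Ω, μ)`. -/
structure IsPoissonProcess {Ω : Type*} [MeasurableSpace Ω] (μ : Measure Ω) (R : ℝ≥0)
    (N : Ω → CountingPath) : Prop where
  measurable : ∀ t : ℝ≥0, Measurable (fun ω => N ω t)
  indep_increments : HasIndepIncrements (fun t ω => N ω t) μ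
  law_increment : ∀ s t : ℝ≥0, s ≤ t →
    HasLaw (fun ω => N ω t - N ω s) (poissonMeasure (R * (t - s))) μ

/-- The history `h_t = {x_s : 0 ≤ s ≤ t} ∪ {u_s : 0 ≤ s < t}` of buffer sizes and actions up to
time `t`. -/
structure History where
  time : ℝ≥0
  x : Set.Iic time → ℝ
  u : Set.Iio time → Fin 2

/-- A deterministic association policy: action `0` uses only the free server, action `1` uses
both servers. -/
abbrev Policy := History → Fin 2

/-- The history up to time `t` of a buffer path `x` and an action path `u`. -/
def historyOf (x : ℝ≥0 → ℝ) (u : ℝ≥0 → Fin 2) (t : ℝ≥0) : History where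
  time := t
  x s := x s
  u s := u s

/-- `(x, u)` are the buffer and action paths generated by the policy `π` from the initial buffer
size `D`, when `n` and `nc` are the arrival paths of the free and of the costly server:
`u_t = π(h_t)` and `x_t = D + n_t + ∫₀ᵗ u_s dnc_s - t` (Lebesgue–Stieltjes integral over
`(0, t]`). -/
structure IsClosedLoop (π : Policy) (D : ℝ) (n nc : CountingPath)
    (x : ℝ≥0 → ℝ) (u : ℝ≥0 → Fin 2) : Prop where
  action : ∀ t, u t = π (historyOf x u t)
  buffer : ∀ t : ℝ≥0, x t =
    D + (n t : ℝ) + (∫ s in Set.Ioc 0 t, ((u s : ℕ) : ℝ) ∂nc.stieltjes.measure) - (t : ℝ)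

/-- The buffer path and the action path generated by `π` (meaningful when the closed-loop system
has exactly one solution; the well-posedness for safe policies is part of the main theorem). -/
noncomputable def closedLoop (π : Policy) (D : ℝ) (n nc : CountingPath) :
    (ℝ≥0 → ℝ) × (ℝ≥0 → Fin 2) :=
  Classical.epsilon fun p => IsClosedLoop π D n nc p.1 p.2

/-- `τ_e = inf {t : x_t ≤ 0}`. -/
noncomputable def emptyTime (x : ℝ≥0 → ℝ) : ℝ≥0∞ :=
  ⨅ (t : ℝ≥0) (_ : x t ≤ 0), (t : ℝ≥0∞)

/-- `τ_f = inf {t : x_t ≥ F - t}`, the time of completing the download of a file of size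
`F ∈ [0, ∞]`. -/
noncomputable def downloadTime (F : ℝ≥0∞) (x : ℝ≥0 → ℝ) : ℝ≥0∞ :=
  ⨅ (t : ℝ≥0) (_ : (F : EReal) - ((t : ℝ) : EReal) ≤ (x t : EReal)), (t : ℝ≥0∞)

section Model

variable {Ω : Type*} [MeasurableSpace Ω] (μ : Measure Ω) (N Nc : Ω → CountingPath)

/-- The interruption probability `p^π(D) = P(τ_e < τ_f)` for file size `F`. -/
noncomputable def interruptionProb (F : ℝ≥0∞) (π : Policy) (D : ℝ) : ℝ≥0∞ :=
  μ {ω | emptyTime (closedLoop π D (N ω) (Nc ω)).1 < downloadTime F (closedLoop π D (N ω) (Nc ω)).1}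

/-- `π` is `(D, ε)`-feasible for file size `F`. -/
def IsFeasible (F : ℝ≥0∞) (π : Policy) (D ε : ℝ) : Prop :=
  interruptionProb μ N Nc F π D ≤ ENNReal.ofReal ε

open Classical in
/-- The usage cost `J^π(D, ε) = E[∫₀^F u_t dt]`; the cost of an infeasible policy is infinite. -/
noncomputable def usageCost (F : ℝ≥0∞) (π : Policy) (D ε : ℝ) : ℝ≥0∞ :=
  if IsFeasible μ N Nc F π D ε then
    ∫⁻ ω, ∫⁻ t in {t : ℝ | 0 ≤ t ∧ ENNReal.ofReal t ≤ F},
      (((closedLoop π D (N ω) (Nc ω)).2 t.toNNReal : ℕ) : ℝ≥0∞) ∂volume ∂μ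
  else ⊤

end Model

/-- `r̄(R)`, the largest root of `γ(r) = r + R (e^{-r} - 1)`. -/
noncomputable def rBar (R : ℝ) : ℝ :=
  sSup {r : ℝ | r + R * (Real.exp (-r) - 1) = 0}

/-- The region of the pairs `(D, ε)` with
`(1/r̄(R₁)) log (1/ε) ≤ D ≤ (1/r̄(R₀)) log (1/ε)`. -/
def qoeRegion (R₀ R₁ : ℝ) : Set (ℝ × ℝ) :=
  {p | 0 < p.2 ∧ 1 / rBar R₁ * Real.log (1 / p.2) ≤ p.1 ∧
    p.1 ≤ 1 / rBar R₀ * Real.log (1 / p.2)}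

/-- The first time in `[0, t]` at which the buffer size is at least `S` (`∞` if there is none),
read off the history up to time `t`. -/
noncomputable def History.crossingTime (h : History) (S : ℝ) : ℝ≥0∞ :=
  ⨅ (s : Set.Iic h.time) (_ : S ≤ h.x s), ((s : ℝ≥0) : ℝ≥0∞)

open Classical in
/-- The online safe policy with threshold `S`: both servers are used at time `t` if and only if
`t ≤ τ_S = inf {s : x_s ≥ S}`. (The inequality `t ≤ τ_S` is decided by the history up to `t`.) -/
noncomputable def safePolicy (S : ℝ) : Policy := fun h =>
  if (h.time : ℝ≥0∞) ≤ h.crossingTime S then 1 else 0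

/-- `S* = (1/α₀) log (1 / (ε - e^{-α₁ D}))`, where `α₀ = r̄(R₀)` and `α₁ = r̄(R₁)`. -/
noncomputable def safeThreshold (R₀ R₁ D ε : ℝ) : ℝ :=
  1 / rBar R₀ * Real.log (1 / (ε - Real.exp (-(rBar R₁ * D))))

/-! Write `m` for the superposition of the two arrival paths, a Poisson process of rate R₁. The
buffer of a safe policy never exceeds `D + m t - t` and equals it until S is reached. Hence τ_S is
the exit time of this explicit path, and the closed loop has one solution: the costly arrivals are
frozen at that time (`isClosedLoop_safePolicy_iff`).

Feasibility. Since exp(-αᵢ(increment - length)) has mean 1 at a root of γ, the potential exp(-α₁x) +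
exp(-α₀S) before τ_S and exp(-α₀x) after it is a supermartingale: at the switch x ≥ S, so the second
term already pays for the new value. It is at least 1 when x ≤ 0, so the maximal inequality bounds
the interruption probability by exp(-α₁D) + exp(-α₀S) (`measure_exists_safeBuffer_le`). This is at
most ε exactly when S ≥ S*.

Cost. The cost is E[τ_S], which increases with S, so S* is optimal. Wald's identity gives E[m(τ_S)]
= R₁E[τ_S]. Almost surely `m` has unit jumps, so D + m(τ_S) - τ_S lies in [S, S + 1). Taking means
gives (R₁ - 1)E[τ_S] = S - D + ξ, with ξ the mean overshoot (`exists_lintegral_exitTime_eq`).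

Both probabilistic arguments are carried out on grids of mesh 1/(k + 1), where they need only
finitely many independent increments. For each fixed path and horizon the grid quantities converge
to the continuous ones, because the path has finitely many jumps there and is right-continuous. -/

namespace CountingPath

/-! ### Counting paths and their exit times. -/

/-- The superposition of two counting paths. -/
def superpose (m n : CountingPath) : CountingPath where
  toFun t := m t + n t
  zero := by simp [m.zero, n.zero]
  mono := m.mono.add n.mono
  right_cont t := (m.right_cont t).add (n.right_cont t)

theorem superpose_apply (m n : CountingPath) (t : ℝ≥0) : m.superpose n t = m t + n t := rfl

theorem exists_eqOn_Ico (m : CountingPath) (a : ℝ≥0) :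
    ∃ b, a < b ∧ ∀ s, a ≤ s → s < b → m s = m a := by
  have h := m.right_cont a
  rw [ContinuousWithinAt, nhds_discrete, Filter.tendsto_pure] at h
  obtain ⟨b, hb, hs⟩ := mem_nhdsGE_iff_exists_Ico_subset.1 h
  exact ⟨b, hb, fun s h1 h2 => hs ⟨h1, h2⟩⟩

/-- The first time at which the path `D + m t - t` is at least `S`. -/
noncomputable def exitTime (m : CountingPath) (S D : ℝ) : ℝ≥0∞ :=
  ⨅ (s : ℝ≥0) (_ : S ≤ D + m s - s), (s : ℝ≥0∞)

theorem le_exitTime_iff (m : CountingPath) (S D : ℝ) (t : ℝ≥0) :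
    (t : ℝ≥0∞) ≤ m.exitTime S D ↔ ∀ s < t, D + m s - s < S := by
  simp only [exitTime, le_iInf_iff, ENNReal.coe_le_coe]
  exact ⟨fun h s hs => not_le.1 fun h' => (h s h').not_gt hs,
    fun h s hs => not_lt.1 fun h' => (h s h').not_ge hs⟩

theorem lt_of_lt_exitTime {m : CountingPath} {S D : ℝ} {s : ℝ≥0}
    (h : (s : ℝ≥0∞) < m.exitTime S D) : D + m s - s < S := by
  by_contra! h'
  exact h.not_ge (iInf₂_le s h')

/-- The infimum is attained: just after τ the count is still `m τ`, while the drift only lowers the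
path. -/
theorem le_of_exitTime_eq {m : CountingPath} {S D : ℝ} {τ : ℝ≥0}
    (h : m.exitTime S D = τ) : S ≤ D + m τ - τ := by
  obtain ⟨b, hb, hm⟩ := m.exists_eqOn_Ico τ
  have hlt : m.exitTime S D < b := by rw [h]; exact_mod_cast hb
  simp only [exitTime, iInf_lt_iff] at hlt
  obtain ⟨s, hs, hsb⟩ := hlt
  have hτs : τ ≤ s := by
    have : m.exitTime S D ≤ s := iInf₂_le s hs
    rw [h] at this
    exact_mod_cast this
  have := hm s hτs (by exact_mod_cast hsb)
  rw [this] at hs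
  have : (τ : ℝ) ≤ s := hτs
  linarith

theorem exitTime_mono (m : CountingPath) (D : ℝ) {S T : ℝ} (h : S ≤ T) :
    m.exitTime S D ≤ m.exitTime T D :=
  iInf_mono fun _ => iInf_mono' fun h' => ⟨h.trans h', le_rfl⟩

/-- The deterministic time `t` capped at the (possibly infinite) time `e`. -/
noncomputable def cap (t : ℝ≥0) (e : ℝ≥0∞) : ℝ≥0 := (min (t : ℝ≥0∞) e).toNNReal

theorem coe_cap (t : ℝ≥0) (e : ℝ≥0∞) : (cap t e : ℝ≥0∞) = min (t : ℝ≥0∞) e :=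
  ENNReal.coe_toNNReal (by simp)

theorem le_cap_iff {s t : ℝ≥0} {e : ℝ≥0∞} : s ≤ cap t e ↔ s ≤ t ∧ (s : ℝ≥0∞) ≤ e := by
  rw [← ENNReal.coe_le_coe, coe_cap, le_min_iff, ENNReal.coe_le_coe]

theorem cap_le (t : ℝ≥0) (e : ℝ≥0∞) : cap t e ≤ t := (le_cap_iff.1 le_rfl).1

theorem cap_eq_left {t : ℝ≥0} {e : ℝ≥0∞} (h : (t : ℝ≥0∞) ≤ e) : cap t e = t := by
  simp [cap, h]

theorem cap_coe_eq_right {t e : ℝ≥0} (h : e ≤ t) : cap t e = e := by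
  simp [cap, h]

end CountingPath

open CountingPath

/-! ### The closed loop of a safe policy. -/

open Classical in
/-- The action path of the safe policy: both servers are used up to the exit time. -/
noncomputable def safeAction (S D : ℝ) (n nc : CountingPath) (t : ℝ≥0) : Fin 2 :=
  if (t : ℝ≥0∞) ≤ (n.superpose nc).exitTime S D then 1 else 0

/-- The buffer path of the safe policy. -/
noncomputable def safeBuffer (S D : ℝ) (n nc : CountingPath) (t : ℝ≥0) : ℝ :=
  D + n t + nc (cap t ((n.superpose nc).exitTime S D)) - t

theorem CountingPath.setIntegral_one (m : CountingPath) (t : ℝ≥0) :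
    ∫ _ in Set.Ioc 0 t, (1 : ℝ) ∂m.stieltjes.measure = m t := by
  have : m.stieltjes 0 = 0 := by simp [stieltjes, m.zero]
  have h : m.stieltjes t = m t := rfl
  simp [Measure.real, this, h]

theorem CountingPath.integrableOn_one (m : CountingPath) (t : ℝ≥0) :
    IntegrableOn (fun _ => (1 : ℝ)) (Set.Ioc 0 t) m.stieltjes.measure := by
  simp [integrableOn_const_iff]

theorem setIntegral_safeAction (S D : ℝ) (n nc : CountingPath) (t : ℝ≥0) :
    ∫ s in Set.Ioc 0 t, ((safeAction S D n nc s : ℕ) : ℝ) ∂nc.stieltjes.measure =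
      nc (cap t ((n.superpose nc).exitTime S D)) := by
  set e := (n.superpose nc).exitTime S D
  have h1 : (fun s : ℝ≥0 => ((safeAction S D n nc s : ℕ) : ℝ)) =
      Set.indicator {s : ℝ≥0 | (s : ℝ≥0∞) ≤ e} (fun _ => 1) := by
    ext s
    by_cases h : (s : ℝ≥0∞) ≤ e
    · simp [safeAction, Set.indicator, e, if_pos h]
    · simp [safeAction, Set.indicator, e, if_neg h]
  have h2 : MeasurableSet {s : ℝ≥0 | (s : ℝ≥0∞) ≤ e} :=
    measurableSet_le (by fun_prop) (by fun_prop)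
  have h3 : Set.Ioc 0 t ∩ {s : ℝ≥0 | (s : ℝ≥0∞) ≤ e} = Set.Ioc 0 (cap t e) := by
    ext s
    simp only [Set.mem_inter_iff, Set.mem_Ioc, Set.mem_ofPred_eq, le_cap_iff, and_assoc]
  rw [h1, setIntegral_indicator h2, h3, setIntegral_one]

theorem safePolicy_historyOf (S : ℝ) (x : ℝ≥0 → ℝ) (u : ℝ≥0 → Fin 2) (t : ℝ≥0) :
    safePolicy S (historyOf x u t) = 1 ↔ ∀ s < t, x s < S := by
  have h : (((historyOf x u t).time : ℝ≥0) : ℝ≥0∞) ≤ (historyOf x u t).crossingTime S ↔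
      ∀ s < t, x s < S := by
    simp only [History.crossingTime, le_iInf_iff, ENNReal.coe_le_coe, historyOf, Subtype.forall,
      Set.mem_Iic]
    exact ⟨fun h s hs => not_le.1 fun h' => (h s hs.le h').not_gt hs,
      fun h s _ hs => not_lt.1 fun h' => (h s h').not_ge hs⟩
  rw [← h, safePolicy]
  split_ifs with h' <;> simp [h']

theorem eq_of_eq_one_iff {a b : Fin 2} (h : a = 1 ↔ b = 1) : a = b := by
  omega

theorem safeAction_eq_one_iff (S D : ℝ) (n nc : CountingPath) (t : ℝ≥0) :
    safeAction S D n nc t = 1 ↔ (t : ℝ≥0∞) ≤ (n.superpose nc).exitTime S D := by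
  rw [safeAction]
  split_ifs with h <;> simp [h]

/-- The closed-loop system of a safe policy has exactly one solution. -/
theorem isClosedLoop_safePolicy_iff (S D : ℝ) (n nc : CountingPath) (x : ℝ≥0 → ℝ)
    (u : ℝ≥0 → Fin 2) :
    IsClosedLoop (safePolicy S) D n nc x u ↔
      x = safeBuffer S D n nc ∧ u = safeAction S D n nc := by
  constructor
  · intro h
    have hu : ∀ t, u t = 1 ↔ ∀ s < t, x s < S := fun t => by
      rw [h.action t, safePolicy_historyOf]
    -- The buffer is dominated by the path with both servers always on (`hle`) and agrees with it as
    -- long as S has not been reached (`heq`). So the two paths stay below S up to the same times,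
    -- which determines `u`.
    have hle : ∀ t, x t ≤ D + (n.superpose nc) t - t := fun t => by
      have : ∫ s in Set.Ioc 0 t, ((u s : ℕ) : ℝ) ∂nc.stieltjes.measure ≤ nc t := by
        rw [← setIntegral_one]
        refine integral_mono_of_nonneg (ae_of_all _ fun s => by positivity)
          (nc.integrableOn_one t) (ae_of_all _ fun s => ?_)
        have : ((u s : ℕ) : ℝ) ≤ 1 := by
          exact_mod_cast (by omega : (u s : ℕ) ≤ 1)
        exact this
      rw [h.buffer t, superpose_apply]
      push_cast
      linarith
    have heq : ∀ t, (∀ s < t, x s < S) → x t = D + (n.superpose nc) t - t := fun t ht => by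
      have : ∫ s in Set.Ioc 0 t, ((u s : ℕ) : ℝ) ∂nc.stieltjes.measure = nc t := by
        rw [← setIntegral_one]
        refine setIntegral_congr_fun measurableSet_Ioc fun s hs => ?_
        have : u s = 1 := (hu s).2 fun r hr => ht r (hr.trans_le hs.2)
        simp [this]
      rw [h.buffer t, superpose_apply, this]
      push_cast
      ring
    have hu' : u = safeAction S D n nc := by
      ext1 t
      apply eq_of_eq_one_iff
      rw [hu, safeAction_eq_one_iff, le_exitTime_iff]
      refine ⟨fun ht s hs => ?_, fun ht s hs => (hle s).trans_lt (ht s hs)⟩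
      rw [← heq s fun r hr => ht r (hr.trans hs)]
      exact ht s hs
    refine ⟨?_, hu'⟩
    ext1 t
    rw [h.buffer t, hu', setIntegral_safeAction, safeBuffer]
  · rintro ⟨rfl, rfl⟩
    refine ⟨fun t => eq_of_eq_one_iff ?_, fun t => by rw [setIntegral_safeAction, safeBuffer]⟩
    rw [safePolicy_historyOf, safeAction_eq_one_iff]
    constructor
    · rintro ht s hs
      have h1 := (le_exitTime_iff _ _ _ _).1 ht s hs
      refine lt_of_le_of_lt ?_ h1
      have h2 : (nc (cap s ((n.superpose nc).exitTime S D)) : ℝ) ≤ nc s := by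
        exact_mod_cast nc.mono (cap_le _ _)
      rw [safeBuffer, superpose_apply]
      push_cast
      linarith
    · intro ht
      -- At τ itself the costly arrivals are not yet frozen, so the buffer has the value of the
      -- superposed path, which is at least S.
      by_contra! hlt
      lift (n.superpose nc).exitTime S D to ℝ≥0 using hlt.ne_top with τ hτ
      have h1 := le_of_exitTime_eq hτ.symm
      have h2 := ht τ (by exact_mod_cast hlt)
      rw [safeBuffer, ← hτ, cap_coe_eq_right le_rfl] at h2
      rw [superpose_apply] at h1
      push_cast at h1
      linarith

theorem existsUnique_isClosedLoop_safePolicy (S D : ℝ) (n nc : CountingPath) :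
    ∃! p : (ℝ≥0 → ℝ) × (ℝ≥0 → Fin 2), IsClosedLoop (safePolicy S) D n nc p.1 p.2 :=
  ⟨(safeBuffer S D n nc, safeAction S D n nc),
    (isClosedLoop_safePolicy_iff S D n nc _ _).2 ⟨rfl, rfl⟩,
    fun _ hp => Prod.ext_iff.2 ((isClosedLoop_safePolicy_iff S D n nc _ _).1 hp)⟩

theorem closedLoop_safePolicy (S D : ℝ) (n nc : CountingPath) :
    closedLoop (safePolicy S) D n nc = (safeBuffer S D n nc, safeAction S D n nc) := by
  have h : IsClosedLoop (safePolicy S) D n nc (closedLoop (safePolicy S) D n nc).1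
      (closedLoop (safePolicy S) D n nc).2 :=
    Classical.epsilon_spec
      (p := fun p : (ℝ≥0 → ℝ) × (ℝ≥0 → Fin 2) => IsClosedLoop (safePolicy S) D n nc p.1 p.2)
      (existsUnique_isClosedLoop_safePolicy S D n nc).exists
  exact Prod.ext_iff.2 ((isClosedLoop_safePolicy_iff S D n nc _ _).1 h)

theorem downloadTime_top (x : ℝ≥0 → ℝ) : downloadTime ⊤ x = ⊤ := by
  simp [downloadTime]

theorem emptyTime_lt_top_iff (x : ℝ≥0 → ℝ) : emptyTime x < ⊤ ↔ ∃ t, x t ≤ 0 := by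
  simp [emptyTime, iInf_lt_iff]

/-- An infinite file is never completed, so an interruption means only that the buffer is empty at
some time. -/
theorem interruptionProb_top_safePolicy {Ω : Type*} [MeasurableSpace Ω] (μ : Measure Ω)
    (N Nc : Ω → CountingPath) (S D : ℝ) :
    interruptionProb μ N Nc ⊤ (safePolicy S) D =
      μ {ω | ∃ t, safeBuffer S D (N ω) (Nc ω) t ≤ 0} := by
  simp only [interruptionProb, downloadTime_top, closedLoop_safePolicy, emptyTime_lt_top_iff]

theorem lintegral_safeAction (S D : ℝ) (n nc : CountingPath) :
    ∫⁻ t in {t : ℝ | 0 ≤ t ∧ ENNReal.ofReal t ≤ ⊤},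
      ((safeAction S D n nc t.toNNReal : ℕ) : ℝ≥0∞) = (n.superpose nc).exitTime S D := by
  set e := (n.superpose nc).exitTime S D with he
  have h1 : (fun t : ℝ => ((safeAction S D n nc t.toNNReal : ℕ) : ℝ≥0∞)) =
      Set.indicator {t : ℝ | ENNReal.ofReal t ≤ e} (fun _ => 1) := by
    ext t
    by_cases h : (t.toNNReal : ℝ≥0∞) ≤ e
    · rw [Set.indicator_of_mem (by exact h), (safeAction_eq_one_iff S D n nc _).2 h]
      simp
    · rw [Set.indicator_of_notMem (by exact h)]
      have := mt (safeAction_eq_one_iff S D n nc _).1 h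
      have : safeAction S D n nc t.toNNReal = 0 := by omega
      simp [this]
  have h2 : MeasurableSet {t : ℝ | ENNReal.ofReal t ≤ e} :=
    measurableSet_le (by fun_prop) (by fun_prop)
  have h3 : {t : ℝ | 0 ≤ t ∧ ENNReal.ofReal t ≤ ⊤} = Set.Ici 0 := by
    ext t; simp
  rw [h1, h3, setLIntegral_indicator h2, setLIntegral_one]
  induction e using ENNReal.recTopCoe with
  | top => simp
  | coe e =>
    have : {t : ℝ | ENNReal.ofReal t ≤ e} ∩ Set.Ici 0 = Set.Icc 0 (e : ℝ) := by
      ext t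
      simp only [Set.mem_inter_iff, Set.mem_ofPred_eq, Set.mem_Ici, Set.mem_Icc,
        ENNReal.ofReal_le_iff_le_toReal ENNReal.coe_ne_top, ENNReal.coe_toReal]
      tauto
    rw [this]
    simp

theorem usageCost_top_safePolicy {Ω : Type*} [MeasurableSpace Ω] {μ : Measure Ω}
    {N Nc : Ω → CountingPath} {S D ε : ℝ} (h : IsFeasible μ N Nc ⊤ (safePolicy S) D ε) :
    usageCost μ N Nc ⊤ (safePolicy S) D ε =
      ∫⁻ ω, ((N ω).superpose (Nc ω)).exitTime S D ∂μ := by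
  rw [usageCost, if_pos h]
  simp only [closedLoop_safePolicy, lintegral_safeAction]

/-! ### Discretisation of time for a fixed path. -/

/-- The mesh `1 / (k + 1)`. -/
noncomputable def mesh (k : ℕ) : ℝ≥0 := ((k : ℝ≥0) + 1)⁻¹

theorem mesh_pos (k : ℕ) : 0 < mesh k := by
  unfold mesh; positivity

theorem natCast_mul_succ_mul_mesh (T : ℝ≥0) (k : ℕ) : T * (k + 1) * mesh k = T := by
  unfold mesh
  field_simp

theorem tendsto_mesh : Filter.Tendsto (fun k => (mesh k : ℝ)) Filter.atTop (nhds 0) := by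
  refine tendsto_one_div_add_atTop_nhds_zero_nat.congr fun k => ?_
  simp [mesh]

theorem eventually_mesh_lt {η : ℝ} (hη : 0 < η) : ∀ᶠ k in Filter.atTop, (mesh k : ℝ) < η :=
  tendsto_mesh.eventually_lt_const hη

namespace CountingPath

theorem exists_isLeast (m : CountingPath) {v : ℕ} {s : ℝ≥0} (hs : v ≤ m s) :
    ∃ a, IsLeast {s | v ≤ m s} a := by
  set A := {s | v ≤ m s}
  have hne : A.Nonempty := ⟨s, hs⟩
  refine ⟨sInf A, ?_, fun r hr => csInf_le (OrderBot.bddBelow _) hr⟩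
  obtain ⟨b, hb, h⟩ := m.exists_eqOn_Ico (sInf A)
  obtain ⟨r, hr, hrb⟩ := exists_lt_of_csInf_lt hne hb
  have : m r = m (sInf A) := h r (csInf_le (OrderBot.bddBelow _) hr) hrb
  change v ≤ m (sInf A)
  rw [← this]
  exact hr

/-- Before the exit time the path `D + m t - t` stays away from `S` on bounded intervals. -/
theorem eventually_lt_sub_mesh (m : CountingPath) (S D : ℝ) (T : ℝ≥0) :
    ∀ᶠ k in Filter.atTop, ∀ s ≤ T, (s : ℝ≥0∞) < m.exitTime S D →
      D + m s - s < S - mesh k := by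
  -- On the times where `m` has a given value v the path is largest at the first of them, so the gap
  -- to S there serves the whole level. Only finitely many levels occur up to T.
  have key : ∀ v ∈ Finset.range (m T + 1), ∀ᶠ k in Filter.atTop, ∀ s : ℝ≥0,
      (s : ℝ≥0∞) < m.exitTime S D → m s = v → D + m s - s < S - mesh k := by
    intro v _
    by_cases hex : ∃ s : ℝ≥0, (s : ℝ≥0∞) < m.exitTime S D ∧ m s = v
    · obtain ⟨s₀, hs₀, hv⟩ := hex
      obtain ⟨a, ha, hmin⟩ := m.exists_isLeast hv.ge
      have has : a ≤ s₀ := hmin hv.ge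
      have hma : m a = v := le_antisymm (hv ▸ m.mono has) ha
      have hlt := lt_of_lt_exitTime (lt_of_le_of_lt (by exact_mod_cast has) hs₀)
      rw [hma] at hlt
      filter_upwards [eventually_mesh_lt (sub_pos.2 hlt)] with k hk s _ hs
      have : (a : ℝ) ≤ s := hmin hs.ge
      rw [hs]
      linarith
    · push Not at hex
      exact Filter.Eventually.of_forall fun k s h1 h2 => absurd h2 (hex s h1)
  filter_upwards [(Finset.eventually_all _).2 key] with k hk s hs hse
  exact hk (m s) (Finset.mem_range_succ_iff.2 (m.mono hs)) s hse rfl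

/-- The path `D + m t - t` is below `S - mesh k` at the first grid points. -/
def BelowOnGrid (m : CountingPath) (S D : ℝ) (k j : ℕ) : Prop :=
  ∀ i ≤ j, D + m (i * mesh k) - (i * mesh k : ℝ≥0) < S - mesh k

/-- The margin `mesh k` in `BelowOnGrid` makes both directions work. After an exit at τ the next
grid point sees a loss of less than one mesh, so the exit is detected; before the exit, a fine
enough mesh is smaller than the gap to S. -/
theorem eventually_belowOnGrid_iff (m : CountingPath) (S D : ℝ) (T : ℝ≥0) :
    ∀ᶠ k in Filter.atTop, ∀ j : ℕ, j * mesh k ≤ T →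
      (m.BelowOnGrid S D k j ↔ ((j * mesh k : ℝ≥0) : ℝ≥0∞) < m.exitTime S D) := by
  filter_upwards [m.eventually_lt_sub_mesh S D T] with k hk j hj
  constructor
  · intro h
    by_contra! hle
    have hfin : m.exitTime S D ≠ ⊤ := ne_top_of_le_ne_top ENNReal.coe_ne_top hle
    lift m.exitTime S D to ℝ≥0 using hfin with τ hτ
    have hS := le_of_exitTime_eq hτ.symm
    have hle' : τ ≤ j * mesh k := by exact_mod_cast hle
    have hpos := mesh_pos k
    have h1 : τ ≤ ⌈τ / mesh k⌉₊ * mesh k := by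
      rw [← div_le_iff₀ hpos]; exact Nat.le_ceil _
    have h2 : (⌈τ / mesh k⌉₊ : ℝ≥0) * mesh k < τ + mesh k := by
      have := Nat.ceil_lt_add_one (a := τ / mesh k) zero_le
      calc (⌈τ / mesh k⌉₊ : ℝ≥0) * mesh k < (τ / mesh k + 1) * mesh k := by gcongr
        _ = τ + mesh k := by field_simp
    have h3 : ⌈τ / mesh k⌉₊ ≤ j := Nat.ceil_le.2 ((div_le_iff₀ hpos).2 hle')
    have h4 := h _ h3
    have h5 : (m τ : ℝ) ≤ m (⌈τ / mesh k⌉₊ * mesh k) := by exact_mod_cast m.mono h1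
    have h6 : ((⌈τ / mesh k⌉₊ * mesh k : ℝ≥0) : ℝ) < τ + mesh k := by exact_mod_cast h2
    linarith
  · intro h i hi
    have : (i : ℝ≥0) * mesh k ≤ j * mesh k := by gcongr
    exact hk _ (this.trans hj) (lt_of_le_of_lt (by exact_mod_cast this) h)

theorem eventually_eq_after (f : CountingPath) (e : ℝ≥0∞) :
    ∀ᶠ k in Filter.atTop, ∀ τ : ℝ≥0, e = τ → ∀ s, τ ≤ s → s < τ + mesh k → f s = f τ := by
  induction e using ENNReal.recTopCoe with
  | top => exact Filter.Eventually.of_forall fun k τ h => absurd h.symm ENNReal.coe_ne_top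
  | coe e =>
    obtain ⟨b, hb, hf⟩ := f.exists_eqOn_Ico e
    filter_upwards [eventually_mesh_lt (sub_pos.2 (NNReal.coe_lt_coe.2 hb))] with k hk τ hτ s h1 h2
    obtain rfl : e = τ := by exact_mod_cast hτ
    refine hf s h1 (h2.trans ?_)
    rw [← NNReal.coe_lt_coe]
    push_cast
    linarith

open Classical in
/-- The growth of `f` over the grid intervals that start below the threshold. -/
noncomputable def stepSum (f m : CountingPath) (S D : ℝ) (k J : ℕ) : ℕ :=
  ∑ j ∈ Finset.range J,
    if m.BelowOnGrid S D k j then f ((j + 1 : ℕ) * mesh k) - f (j * mesh k) else 0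

/-- The sum telescopes up to the first grid point at or after the exit time τ. For a fine mesh `f`
is constant from τ to that point, so rounding τ up changes nothing. -/
theorem eventually_stepSum_eq (f m : CountingPath) (S D : ℝ) (T : ℝ≥0) :
    ∀ᶠ k in Filter.atTop, ∀ J : ℕ, J * mesh k ≤ T →
      f.stepSum m S D k J = f (cap (J * mesh k) (m.exitTime S D)) := by
  filter_upwards [m.eventually_belowOnGrid_iff S D T, f.eventually_eq_after (m.exitTime S D)]
    with k hk hf J
  induction J with
  | zero =>
    intro _
    have : cap ((0 : ℕ) * mesh k) (m.exitTime S D) = 0 := by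
      have := cap_le ((0 : ℕ) * mesh k) (m.exitTime S D)
      simpa using this
    rw [this, f.zero]
    simp [stepSum]
  | succ J ih =>
    intro hJ
    have hle : (J : ℝ≥0) * mesh k ≤ (J + 1 : ℕ) * mesh k := by gcongr; simp
    have hJT := hle.trans hJ
    rw [stepSum, Finset.sum_range_succ, ← stepSum, ih hJT]
    by_cases hlt : ((J * mesh k : ℝ≥0) : ℝ≥0∞) < m.exitTime S D
    · rw [if_pos ((hk J hJT).2 hlt), cap_eq_left hlt.le, Nat.add_sub_cancel' (f.mono hle)]
      rcases le_or_gt (((J + 1 : ℕ) * mesh k : ℝ≥0) : ℝ≥0∞) (m.exitTime S D) with h | h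
      · rw [cap_eq_left h]
      · lift m.exitTime S D to ℝ≥0 using h.ne_top with τ hτ
        have h1 : τ ≤ (J + 1 : ℕ) * mesh k := by exact_mod_cast h.le
        rw [cap_coe_eq_right h1]
        refine hf τ rfl _ h1 ?_
        have h2 : J * mesh k < τ := by exact_mod_cast hlt
        calc ((J + 1 : ℕ) : ℝ≥0) * mesh k = J * mesh k + mesh k := by push_cast; ring
          _ < τ + mesh k := by gcongr
    · rw [if_neg (mt (hk J hJT).1 hlt), add_zero]
      push Not at hlt
      congr 1
      simp only [cap]
      rw [min_eq_right hlt, min_eq_right (hlt.trans (by exact_mod_cast hle))]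

-- The sum is the exit time rounded up to the grid, which costs at most one mesh.
open Classical in
theorem eventually_sum_mesh (m : CountingPath) (S D : ℝ) (T : ℝ≥0) :
    ∀ᶠ k in Filter.atTop, ∀ J : ℕ, J * mesh k ≤ T →
      cap (J * mesh k) (m.exitTime S D) ≤
          ∑ j ∈ Finset.range J, (if m.BelowOnGrid S D k j then mesh k else 0) ∧
        ∑ j ∈ Finset.range J, (if m.BelowOnGrid S D k j then mesh k else 0) ≤
          cap (J * mesh k) (m.exitTime S D) + mesh k := by
  filter_upwards [m.eventually_belowOnGrid_iff S D T] with k hk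
  have key : ∀ J : ℕ, J * mesh k ≤ T →
      (((J * mesh k : ℝ≥0) : ℝ≥0∞) < m.exitTime S D →
        ∑ j ∈ Finset.range J, (if m.BelowOnGrid S D k j then mesh k else 0) = J * mesh k) ∧
      (∀ τ : ℝ≥0, m.exitTime S D = τ → τ ≤ J * mesh k →
        τ ≤ ∑ j ∈ Finset.range J, (if m.BelowOnGrid S D k j then mesh k else 0) ∧
        ∑ j ∈ Finset.range J, (if m.BelowOnGrid S D k j then mesh k else 0) ≤ τ + mesh k) := by
    intro J
    induction J with
    | zero =>
      intro _
      refine ⟨fun _ => by simp, fun τ _ hle => ?_⟩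
      have : τ = 0 := by simpa using hle
      simp [this]
    | succ J ih =>
      intro hJ
      have hle : (J : ℝ≥0) * mesh k ≤ (J + 1 : ℕ) * mesh k := by gcongr; simp
      have hJT := hle.trans hJ
      have hs : ((J + 1 : ℕ) : ℝ≥0) * mesh k = J * mesh k + mesh k := by push_cast; ring
      obtain ⟨ih1, ih2⟩ := ih hJT
      rw [Finset.sum_range_succ]
      refine ⟨fun h => ?_, fun τ hτ h => ?_⟩
      · have h' := lt_of_le_of_lt (ENNReal.coe_le_coe.2 hle) h
        rw [if_pos ((hk J hJT).2 h'), ih1 h', hs]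
      · rcases lt_or_ge (J * mesh k) τ with h' | h'
        · have h'' : ((J * mesh k : ℝ≥0) : ℝ≥0∞) < m.exitTime S D := by
            rw [hτ]; exact_mod_cast h'
          rw [if_pos ((hk J hJT).2 h''), ih1 h'', ← hs]
          refine ⟨h, ?_⟩
          rw [hs]
          gcongr
        · have h'' : ¬ ((J * mesh k : ℝ≥0) : ℝ≥0∞) < m.exitTime S D := by
            rw [hτ]; exact_mod_cast h'.not_gt
          rw [if_neg (mt (hk J hJT).1 h''), add_zero]
          exact ih2 τ hτ h'
  intro J hJ
  obtain ⟨h1, h2⟩ := key J hJ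
  by_cases h : ((J * mesh k : ℝ≥0) : ℝ≥0∞) < m.exitTime S D
  · rw [h1 h, cap_eq_left h.le]
    simp
  · push Not at h
    lift m.exitTime S D to ℝ≥0 using ne_top_of_le_ne_top ENNReal.coe_ne_top h with τ hτ
    have h' : τ ≤ J * mesh k := by exact_mod_cast h
    rw [cap_coe_eq_right h']
    exact h2 τ rfl h'

end CountingPath

/-- The buffer size at the grid points, when the costly server is used over the grid intervals
that start below the threshold. -/
noncomputable def gridBuffer (S D : ℝ) (n nc : CountingPath) (k j : ℕ) : ℝ :=
  D + n (j * mesh k) + nc.stepSum (n.superpose nc) S D k j - (j * mesh k : ℝ≥0)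

/-- Rounding t down to the grid can only lower the arrivals and undoes less than one mesh of drift.
-/
theorem eventually_gridBuffer_le {S D : ℝ} {n nc : CountingPath} {T : ℕ} {t : ℝ≥0} (ht : t ≤ T)
    (hx : safeBuffer S D n nc t ≤ 0) :
    ∀ᶠ k in Filter.atTop, ∃ j ≤ T * (k + 1), gridBuffer S D n nc k j ≤ mesh k := by
  filter_upwards [nc.eventually_stepSum_eq (n.superpose nc) S D T] with k hk
  have hpos := mesh_pos k
  set j := ⌊t / mesh k⌋₊ with hj
  have h1 : j * mesh k ≤ t := by
    rw [← le_div_iff₀ hpos]; exact Nat.floor_le zero_le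
  have h2 : t < j * mesh k + mesh k := by
    have h := Nat.lt_floor_add_one (t / mesh k)
    rw [div_lt_iff₀ hpos] at h
    calc t < (j + 1) * mesh k := h
      _ = j * mesh k + mesh k := by ring
  have h3 : (j : ℝ≥0) ≤ T * (k + 1) := by
    have : (j : ℝ≥0) * mesh k ≤ T * (k + 1) * mesh k := by
      rw [natCast_mul_succ_mul_mesh]; exact h1.trans ht
    exact le_of_mul_le_mul_right this hpos
  refine ⟨j, by exact_mod_cast h3, ?_⟩
  rw [gridBuffer, hk j (h1.trans ht)]
  rw [safeBuffer] at hx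
  have h4 : (n (j * mesh k) : ℝ) ≤ n t := by exact_mod_cast n.mono h1
  have h5 : (nc (cap (j * mesh k) ((n.superpose nc).exitTime S D)) : ℝ) ≤
      nc (cap t ((n.superpose nc).exitTime S D)) := by
    refine Nat.cast_le.2 (nc.mono (le_cap_iff.2 ⟨(cap_le _ _).trans h1, ?_⟩))
    exact (le_cap_iff.1 le_rfl).2
  have h6 : (t : ℝ) < (j * mesh k : ℝ≥0) + mesh k := by exact_mod_cast h2
  linarith

/-! ### The largest root of γ. -/

theorem isClosed_setOf_rBar_root (R : ℝ) :
    IsClosed {r : ℝ | r + R * (Real.exp (-r) - 1) = 0} :=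
  isClosed_eq (by fun_prop) (by fun_prop)

theorem bddAbove_setOf_rBar_root {R : ℝ} (hR : 0 ≤ R) :
    BddAbove {r : ℝ | r + R * (Real.exp (-r) - 1) = 0} := by
  refine ⟨R, fun r hr => ?_⟩
  have hr : r + R * (Real.exp (-r) - 1) = 0 := hr
  nlinarith [mul_nonneg hR (Real.exp_pos (-r)).le]

theorem rBar_root {R : ℝ} (hR : 0 ≤ R) : rBar R + R * (Real.exp (-rBar R) - 1) = 0 :=
  (isClosed_setOf_rBar_root R).csSup_mem ⟨0, by simp⟩ (bddAbove_setOf_rBar_root hR)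

/-- γ is nonpositive at its minimiser log R > 0 and equals R exp(-R) > 0 at R, so it has a root
between them. -/
theorem rBar_pos {R : ℝ} (hR : 1 < R) : 0 < rBar R := by
  have h0 : 0 < Real.log R := Real.log_pos hR
  have hlog : Real.log R ≤ R - 1 := Real.log_le_sub_one_of_pos (by linarith)
  have hmem : (0 : ℝ) ∈ Set.Icc (Real.log R + R * (Real.exp (-Real.log R) - 1))
      (R + R * (Real.exp (-R) - 1)) := by
    constructor
    · rw [Real.exp_neg, Real.exp_log (by linarith), mul_sub, mul_inv_cancel₀ (by linarith)]
      linarith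
    · have := mul_pos (by linarith : 0 < R) (Real.exp_pos (-R))
      linarith
  obtain ⟨r, hr, hr0⟩ := intermediate_value_Icc (by linarith : Real.log R ≤ R)
    (f := fun r => r + R * (Real.exp (-r) - 1)) (by fun_prop) hmem
  exact h0.trans_le (hr.1.trans (le_csSup (bddAbove_setOf_rBar_root (by linarith)) hr0))

/-! ### Moments and tail of the Poisson law. -/

theorem lintegral_poissonMeasure (r : ℝ≥0) (f : ℕ → ℝ≥0∞) :
    ∫⁻ n, f n ∂poissonMeasure r =
      ∑' n, ENNReal.ofReal (Real.exp (-r) * r ^ n / n.factorial) * f n := by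
  simp [poissonMeasure, lintegral_sum_measure, lintegral_smul_measure]

theorem lintegral_exp_poissonMeasure (r : ℝ≥0) (a : ℝ) :
    ∫⁻ n, ENNReal.ofReal (Real.exp (-(a * n))) ∂poissonMeasure r =
      ENNReal.ofReal (Real.exp (r * (Real.exp (-a) - 1))) := by
  have hs : HasSum (fun n : ℕ => Real.exp (-r) * r ^ n / n.factorial * Real.exp (-(a * n)))
      (Real.exp (r * (Real.exp (-a) - 1))) := by
    have h := (NormedSpace.expSeries_div_hasSum_exp (r * Real.exp (-a) : ℝ)).mul_left
      (Real.exp (-r))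
    rw [← Real.exp_eq_exp_ℝ, ← Real.exp_add] at h
    convert! h using 1
    · ext n
      rw [mul_pow, ← Real.exp_nat_mul]
      ring_nf
    · ring_nf
  rw [lintegral_poissonMeasure, ← hs.tsum_eq, ENNReal.ofReal_tsum_of_nonneg
    (fun n => by positivity) hs.summable]
  simp_rw [ENNReal.ofReal_mul' (Real.exp_pos _).le]

theorem lintegral_natCast_poissonMeasure (r : ℝ≥0) :
    ∫⁻ n, (n : ℝ≥0∞) ∂poissonMeasure r = r := by
  have hterm : ∀ n : ℕ, ENNReal.ofReal (Real.exp (-r) * r ^ (n + 1) / (n + 1).factorial) *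
      ((n + 1 : ℕ) : ℝ≥0∞) = r * ENNReal.ofReal (Real.exp (-r) * r ^ n / n.factorial) := by
    intro n
    rw [← ENNReal.ofReal_natCast (n + 1), ← ENNReal.ofReal_coe_nnreal (p := r),
      ← ENNReal.ofReal_mul (by positivity), ← ENNReal.ofReal_mul (by positivity)]
    congr 1
    rw [Nat.factorial_succ]
    push_cast
    field_simp
    ring
  rw [lintegral_poissonMeasure, tsum_eq_zero_add' ENNReal.summable]
  simp_rw [hterm]
  rw [ENNReal.tsum_mul_left, ← ENNReal.ofReal_tsum_of_nonneg (fun n => by positivity)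
    (hasSum_one_poissonMeasure r).summable, (hasSum_one_poissonMeasure r).tsum_eq]
  simp

theorem poissonMeasure_two_le (r : ℝ≥0) : poissonMeasure r {n | 2 ≤ n} ≤ r ^ 2 := by
  have h1 : ({n | 2 ≤ n} : Set ℕ) = ({0, 1} : Set ℕ)ᶜ := by
    ext n; simp; omega
  have h2 : (poissonMeasure r).real {0, 1} = Real.exp (-r) * (1 + r) := by
    rw [← Set.singleton_union, measureReal_union (by simp) (by simp),
      poissonMeasure_real_singleton, poissonMeasure_real_singleton]
    simp
    ring
  have h3 : (poissonMeasure r).real {n | 2 ≤ n} ≤ (r : ℝ) ^ 2 := by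
    rw [h1, probReal_compl_eq_one_sub (by simp), h2]
    -- The tail is 1 - exp(-r)(1 + r) ≤ 1 - (1 - r)(1 + r) = r².
    have h4 := Real.add_one_le_exp (-(r : ℝ))
    nlinarith [mul_le_mul_of_nonneg_right h4 (by positivity : (0 : ℝ) ≤ 1 + r)]
  rw [← ENNReal.ofReal_coe_nnreal (p := r), ← ENNReal.ofReal_pow (by positivity)]
  exact (ENNReal.le_ofReal_iff_toReal_le (by simp) (by positivity)).2 h3

section HasLaw

variable {Ω : Type*} [MeasurableSpace Ω] {μ : Measure Ω} {X : Ω → ℕ} {r : ℝ≥0}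

theorem lintegral_of_hasLaw_poissonMeasure (hX : HasLaw X (poissonMeasure r) μ)
    (f : ℕ → ℝ≥0∞) : ∫⁻ ω, f (X ω) ∂μ = ∫⁻ n, f n ∂poissonMeasure r := by
  rw [← hX.map_eq, lintegral_map' (measurable_of_countable f).aemeasurable hX.aemeasurable]

/-- The exponential moment of a Poisson increment at the positive root of the exponent
`r + R (e^{-r} - 1)`. -/
theorem lintegral_exp_of_hasLaw_poissonMeasure {R h : ℝ≥0} {α : ℝ}
    (hα : α + R * (Real.exp (-α) - 1) = 0) (hX : HasLaw X (poissonMeasure (R * h)) μ) :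
    ∫⁻ ω, ENNReal.ofReal (Real.exp (-(α * (X ω - h)))) ∂μ = 1 := by
  have : ∀ n : ℕ, ENNReal.ofReal (Real.exp (-(α * (n - h)))) =
      ENNReal.ofReal (Real.exp (α * h)) * ENNReal.ofReal (Real.exp (-(α * n))) := fun n => by
    rw [← ENNReal.ofReal_mul (Real.exp_pos _).le, ← Real.exp_add]
    ring_nf
  rw [lintegral_of_hasLaw_poissonMeasure hX
    (fun n => ENNReal.ofReal (Real.exp (-(α * (n - h)))))]
  simp_rw [this]
  rw [lintegral_const_mul _ (measurable_of_countable _), lintegral_exp_poissonMeasure,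
    ← ENNReal.ofReal_mul (Real.exp_pos _).le, ← Real.exp_add]
  have : α * h + ((R * h : ℝ≥0) : ℝ) * (Real.exp (-α) - 1) = 0 := by
    push_cast
    linear_combination (h : ℝ) * hα
  rw [this]
  simp

end HasLaw

/-! ### Independence of the next grid increments from the grid history. -/

section Indep

variable {Ω : Type*} {mΩ : MeasurableSpace Ω} {μ : Measure Ω} [IsProbabilityMeasure μ]

/-- Used with A, B the histories and C, D the next increments of the two processes. All four are
then mutually independent, and countability reduces the claim to a product formula on points. -/
theorem indepFun_prodMk_prodMk_of_countable {α β γ δ : Type*}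
    [MeasurableSpace α] [Countable α] [MeasurableSingletonClass α]
    [MeasurableSpace β] [Countable β] [MeasurableSingletonClass β]
    [MeasurableSpace γ] [Countable γ] [MeasurableSingletonClass γ]
    [MeasurableSpace δ] [Countable δ] [MeasurableSingletonClass δ]
    {A : Ω → α} {B : Ω → β} {C : Ω → γ} {D : Ω → δ}
    (hA : Measurable A) (hB : Measurable B) (hC : Measurable C) (hD : Measurable D)
    (h : IndepFun (fun ω => (A ω, C ω)) (fun ω => (B ω, D ω)) μ)
    (hAC : IndepFun A C μ) (hBD : IndepFun B D μ) :
    IndepFun (fun ω => (A ω, B ω)) (fun ω => (C ω, D ω)) μ := by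
  have hAB : IndepFun A B μ := h.comp measurable_fst measurable_fst
  have hCD : IndepFun C D μ := h.comp measurable_snd measurable_snd
  rw [indepFun_iff_map_prod_eq_prod_map_map (by fun_prop) (by fun_prop)]
  refine Measure.ext_of_singleton fun ⟨⟨a, b⟩, ⟨c, d⟩⟩ => ?_
  rw [← Set.singleton_prod_singleton, Measure.prod_prod,
    Measure.map_apply (by fun_prop) (.of_discrete),
    Measure.map_apply (by fun_prop) (.of_discrete),
    Measure.map_apply (by fun_prop) (.of_discrete)]
  have e1 : (fun ω => ((A ω, B ω), (C ω, D ω))) ⁻¹' ({(a, b)} ×ˢ {(c, d)}) =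
      (fun ω => (A ω, C ω)) ⁻¹' {(a, c)} ∩ (fun ω => (B ω, D ω)) ⁻¹' {(b, d)} := by
    ext ω; simp; tauto
  rw [e1, h.measure_inter_preimage_eq_mul _ _ .of_discrete .of_discrete]
  simp only [← Set.singleton_prod_singleton, Set.mk_preimage_prod]
  rw [hAC.measure_inter_preimage_eq_mul _ _ .of_discrete .of_discrete,
    hBD.measure_inter_preimage_eq_mul _ _ .of_discrete .of_discrete,
    hAB.measure_inter_preimage_eq_mul _ _ .of_discrete .of_discrete,
    hCD.measure_inter_preimage_eq_mul _ _ .of_discrete .of_discrete]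
  ring

end Indep

namespace CountingPath

/-- The increment of `n` over the `j`-th interval of the grid of mesh `h`. -/
def increment (n : CountingPath) (h : ℝ≥0) (j : ℕ) : ℕ :=
  n ((j + 1 : ℕ) * h) - n (j * h)

theorem sum_increment (n : CountingPath) (h : ℝ≥0) (i : ℕ) :
    ∑ l ∈ Finset.range i, n.increment h l = n (i * h) := by
  have hm : Monotone fun l : ℕ => n ((l : ℝ≥0) * h) := fun a b hab => n.mono (by gcongr)
  simp only [increment]
  rw [Finset.sum_range_tsub hm]
  simp [n.zero]

theorem apply_add_increment (n : CountingPath) (h : ℝ≥0) (j : ℕ) :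
    n (j * h) + n.increment h j = n ((j + 1 : ℕ) * h) :=
  Nat.add_sub_cancel' (n.mono (by gcongr; simp))

theorem increment_superpose (m n : CountingPath) (h : ℝ≥0) (j : ℕ) :
    (m.superpose n).increment h j = m.increment h j + n.increment h j := by
  have h1 := apply_add_increment m h j
  have h2 := apply_add_increment n h j
  have h3 := apply_add_increment (m.superpose n) h j
  simp only [superpose_apply] at h3
  omega

end CountingPath

section GridProcess

variable {Ω : Type*} {mΩ : MeasurableSpace Ω} {μ : Measure Ω}

/-- The increments of `N` over the first `j` intervals of the grid of mesh `h`. -/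
def gridHistory (N : Ω → CountingPath) (h : ℝ≥0) (j : ℕ) (ω : Ω) (i : Finset.range j) : ℕ :=
  (N ω).increment h i

/-- The `σ`-algebra generated by the increments of `N` and `Nc` over the first `j` intervals of
the grid of mesh `h`. -/
@[reducible] def gridSigma (N Nc : Ω → CountingPath) (h : ℝ≥0) (j : ℕ) : MeasurableSpace Ω :=
  MeasurableSpace.comap (fun ω => (gridHistory N h j ω, gridHistory Nc h j ω)) inferInstance

/-- Values at grid points are partial sums of increments. -/
theorem measurable_gridSigma_left (N Nc : Ω → CountingPath) (h : ℝ≥0) {i j : ℕ} (hij : i ≤ j) :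
    Measurable[gridSigma N Nc h j] fun ω => N ω (i * h) := by
  have h1 : Measurable[gridSigma N Nc h j] (fun ω => (gridHistory N h j ω, gridHistory Nc h j ω)) :=
    comap_measurable _
  have h2 : ∀ l ∈ Finset.range i, Measurable[gridSigma N Nc h j] fun ω => (N ω).increment h l := by
    intro l hl
    have hl : l ∈ Finset.range j := Finset.range_mono hij hl
    exact (measurable_pi_apply (⟨l, hl⟩ : Finset.range j)).comp (measurable_fst.comp h1)
  simp_rw [← sum_increment]
  exact Finset.measurable_fun_sum _ h2

theorem measurable_gridSigma_right (N Nc : Ω → CountingPath) (h : ℝ≥0) {i j : ℕ} (hij : i ≤ j) :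
    Measurable[gridSigma N Nc h j] fun ω => Nc ω (i * h) := by
  have h1 : Measurable[gridSigma N Nc h j] (fun ω => (gridHistory N h j ω, gridHistory Nc h j ω)) :=
    comap_measurable _
  have h2 : ∀ l ∈ Finset.range i, Measurable[gridSigma N Nc h j] fun ω => (Nc ω).increment h l := by
    intro l hl
    have hl : l ∈ Finset.range j := Finset.range_mono hij hl
    exact (measurable_pi_apply (⟨l, hl⟩ : Finset.range j)).comp (measurable_snd.comp h1)
  simp_rw [← sum_increment]
  exact Finset.measurable_fun_sum _ h2

namespace IsPoissonProcess

variable {R R₀ Rc : ℝ≥0} {N Nc : Ω → CountingPath}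

theorem measurable_increment (hN : IsPoissonProcess μ R N) (h : ℝ≥0) (j : ℕ) :
    Measurable fun ω => (N ω).increment h j :=
  (hN.measurable _).sub (hN.measurable _)

theorem measurable_gridHistory (hN : IsPoissonProcess μ R N) (h : ℝ≥0) (j : ℕ) :
    Measurable (gridHistory N h j) :=
  measurable_pi_lambda _ fun i => hN.measurable_increment h i

theorem gridSigma_le (hN : IsPoissonProcess μ R₀ N) (hNc : IsPoissonProcess μ Rc Nc)
    (h : ℝ≥0) (j : ℕ) : gridSigma N Nc h j ≤ mΩ :=
  ((hN.measurable_gridHistory h j).prodMk (hNc.measurable_gridHistory h j)).comap_le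

theorem indepFun_gridHistory_increment (hN : IsPoissonProcess μ R N) (h : ℝ≥0) (j : ℕ) :
    IndepFun (gridHistory N h j) (fun ω => (N ω).increment h j) μ := by
  have hi := hN.indep_increments.nat (t := fun j : ℕ => (j : ℝ≥0) * h)
    (fun a b hab => by simp only; gcongr)
  have := hi.indepFun_finset (Finset.range j) {j} (by simp)
    (fun i => hN.measurable_increment h i)
  have hψ : Measurable fun g : ({j} : Finset ℕ) → ℕ => g ⟨j, by simp⟩ := measurable_pi_apply _
  exact this.comp measurable_id hψ

theorem hasLaw_increment (hN : IsPoissonProcess μ R N) (h : ℝ≥0) (j : ℕ) :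
    HasLaw (fun ω => (N ω).increment h j) (poissonMeasure (R * h)) μ := by
  have := hN.law_increment (j * h) ((j + 1 : ℕ) * h) (by gcongr; simp)
  have e : ((j + 1 : ℕ) : ℝ≥0) * h - j * h = h := by
    push_cast
    rw [add_mul, one_mul, add_tsub_cancel_left]
  rwa [e] at this

theorem hasLaw_increment_superpose (hN : IsPoissonProcess μ R₀ N)
    (hNc : IsPoissonProcess μ Rc Nc)
    (hind : IndepFun (fun ω t => N ω t) (fun ω t => Nc ω t) μ) (h : ℝ≥0) (j : ℕ) :
    HasLaw (fun ω => ((N ω).superpose (Nc ω)).increment h j)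
      (poissonMeasure ((R₀ + Rc) * h)) μ := by
  have hφ : Measurable fun f : ℝ≥0 → ℕ => f ((j + 1 : ℕ) * h) - f (j * h) := by fun_prop
  have hi : IndepFun (fun ω => (N ω).increment h j) (fun ω => (Nc ω).increment h j) μ :=
    hind.comp hφ hφ
  have := hi.hasLaw_add_poissonMeasure (hN.hasLaw_increment h j) (hNc.hasLaw_increment h j)
  rw [add_mul]
  convert! this using 2 with ω
  exact increment_superpose _ _ _ _

variable [IsProbabilityMeasure μ]

theorem indep_gridSigma (hN : IsPoissonProcess μ R₀ N) (hNc : IsPoissonProcess μ Rc Nc)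
    (hind : IndepFun (fun ω t => N ω t) (fun ω t => Nc ω t) μ) (h : ℝ≥0) (j : ℕ) :
    IndepFun (fun ω => (gridHistory N h j ω, gridHistory Nc h j ω))
      (fun ω => ((N ω).increment h j, (Nc ω).increment h j)) μ := by
  refine indepFun_prodMk_prodMk_of_countable (hN.measurable_gridHistory h j)
    (hNc.measurable_gridHistory h j) (hN.measurable_increment h j) (hNc.measurable_increment h j)
    ?_ (hN.indepFun_gridHistory_increment h j) (hNc.indepFun_gridHistory_increment h j)
  have hφ : Measurable fun f : ℝ≥0 → ℕ =>
      ((fun i : Finset.range j => f ((i + 1 : ℕ) * h) - f (i * h)),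
        f ((j + 1 : ℕ) * h) - f (j * h)) := by
    fun_prop
  exact hind.comp hφ hφ

/-- Functions of the grid history and of the next increments are uncorrelated. -/
theorem lintegral_mul_increment (hN : IsPoissonProcess μ R₀ N) (hNc : IsPoissonProcess μ Rc Nc)
    (hind : IndepFun (fun ω t => N ω t) (fun ω t => Nc ω t) μ) (h : ℝ≥0) (j : ℕ)
    {F : Ω → ℝ≥0∞} (hF : Measurable[gridSigma N Nc h j] F) (g : ℕ → ℕ → ℝ≥0∞) :
    ∫⁻ ω, F ω * g ((N ω).increment h j) ((Nc ω).increment h j) ∂μ =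
      (∫⁻ ω, F ω ∂μ) * ∫⁻ ω, g ((N ω).increment h j) ((Nc ω).increment h j) ∂μ := by
  have hW : Measurable fun ω => ((N ω).increment h j, (Nc ω).increment h j) :=
    (hN.measurable_increment h j).prodMk (hNc.measurable_increment h j)
  have hg : Measurable (Function.uncurry g) := measurable_of_countable _
  exact lintegral_mul_eq_lintegral_mul_lintegral_of_independent_measurableSpace
    (hN.gridSigma_le hNc h j) hW.comap_le (hN.indep_gridSigma hNc hind h j) hF
    (hg.comp (comap_measurable fun ω => ((N ω).increment h j, (Nc ω).increment h j)))

end IsPoissonProcess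

end GridProcess

/-! ### The supermartingale on the grid and the interruption probability. -/

/-- The maximal inequality for nonnegative supermartingales. -/
theorem mul_measure_exists_le_of_setLIntegral_le {Ω : Type*} {mΩ : MeasurableSpace Ω}
    {μ : Measure Ω} (c : ℝ≥0∞) (Φ : ℕ → Ω → ℝ≥0∞) (𝓕 : ℕ → MeasurableSpace Ω)
    (hle : ∀ j, 𝓕 j ≤ mΩ) (hmeas : ∀ i j, i ≤ j → Measurable[𝓕 j] (Φ i))
    (hsuper : ∀ j s, MeasurableSet[𝓕 j] s → ∫⁻ ω in s, Φ (j + 1) ω ∂μ ≤ ∫⁻ ω in s, Φ j ω ∂μ)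
    (J : ℕ) : c * μ {ω | ∃ j ≤ J, c ≤ Φ j ω} ≤ ∫⁻ ω, Φ 0 ω ∂μ := by
  have hΦ : ∀ j, Measurable (Φ j) := fun j => (hmeas j j le_rfl).mono (hle j) le_rfl
  -- Induction invariant: on paths that have already reached c only the amount c is kept, on the
  -- others the current value of Φ. Passing to `J + 1` moves the paths with Φ_J ≥ c to the first
  -- term.
  have key : ∀ J : ℕ, c * μ {ω | ∃ j < J, c ≤ Φ j ω} +
      ∫⁻ ω in {ω | ∀ j < J, Φ j ω < c}, Φ J ω ∂μ ≤ ∫⁻ ω, Φ 0 ω ∂μ := by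
    intro J
    induction J with
    | zero => simp
    | succ J ih =>
      refine le_trans ?_ ih
      set H : Set Ω := {ω | ∀ j < J, Φ j ω < c}
      set B : Set Ω := {ω | c ≤ Φ J ω}
      have hB : MeasurableSet B := measurableSet_le measurable_const (hΦ J)
      have hH : MeasurableSet[𝓕 J] H := by
        have : H = ⋂ j, ⋂ (_ : j < J), {ω | Φ j ω < c} := by ext; simp [H]
        rw [this]
        exact MeasurableSet.iInter fun j => MeasurableSet.iInter fun hj =>
          measurableSet_lt (hmeas j J hj.le) measurable_const
      have hHB : MeasurableSet[𝓕 J] (H \ B) :=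
        hH.diff (measurableSet_le measurable_const (hmeas J J le_rfl))
      have e1 : {ω | ∃ j < J + 1, c ≤ Φ j ω} ⊆ {ω | ∃ j < J, c ≤ Φ j ω} ∪ (H ∩ B) := by
        rintro ω ⟨j, hj, hc⟩
        by_cases h : ∃ j < J, c ≤ Φ j ω
        · exact Or.inl h
        · push Not at h
          refine Or.inr ⟨h, ?_⟩
          rcases Nat.lt_succ_iff_lt_or_eq.1 hj with h' | rfl
          · exact absurd hc (h j h').not_ge
          · exact hc
      have e2 : {ω | ∀ j < J + 1, Φ j ω < c} = H \ B := by
        ext ω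
        simp only [Set.mem_ofPred_eq, Set.mem_sdiff, not_le, H, B]
        exact ⟨fun h => ⟨fun j hj => h j (by omega), h J (by omega)⟩, fun h j hj =>
          (Nat.lt_succ_iff_lt_or_eq.1 hj).elim (h.1 j) fun h' => h' ▸ h.2⟩
      rw [e2]
      have e3 : c * μ (H ∩ B) ≤ ∫⁻ ω in H ∩ B, Φ J ω ∂μ := by
        rw [← setLIntegral_const]
        exact setLIntegral_mono' ((hle J _ hH).inter hB) fun ω hω => hω.2
      calc c * μ {ω | ∃ j < J + 1, c ≤ Φ j ω} + ∫⁻ ω in H \ B, Φ (J + 1) ω ∂μ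
          ≤ (c * μ {ω | ∃ j < J, c ≤ Φ j ω} + ∫⁻ ω in H ∩ B, Φ J ω ∂μ) +
            ∫⁻ ω in H \ B, Φ J ω ∂μ := by
            refine add_le_add ?_ (hsuper J _ hHB)
            refine le_trans (mul_le_mul_right ((measure_mono e1).trans (measure_union_le _ _)) c) ?_
            rw [mul_add]
            exact add_le_add le_rfl e3
        _ = _ := by rw [add_assoc, lintegral_inter_add_sdiff _ _ hB]
  have h := le_trans le_self_add (key (J + 1))
  simpa only [Nat.lt_succ_iff] using h

section Measurability

variable {Ω : Type*} {m : MeasurableSpace Ω} {N Nc : Ω → CountingPath} {S D : ℝ} {k J : ℕ}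

theorem measurableSet_belowOnGrid (hN : ∀ i ≤ J, Measurable fun ω => N ω (i * mesh k))
    (hNc : ∀ i ≤ J, Measurable fun ω => Nc ω (i * mesh k)) {j : ℕ} (hj : j ≤ J) :
    MeasurableSet {ω | ((N ω).superpose (Nc ω)).BelowOnGrid S D k j} := by
  have : {ω | ((N ω).superpose (Nc ω)).BelowOnGrid S D k j} =
      ⋂ i, ⋂ (_ : i ≤ j), {ω | D + ((N ω (i * mesh k) + Nc ω (i * mesh k) : ℕ) : ℝ) -
        (i * mesh k : ℝ≥0) < S - mesh k} := by
    ext ω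
    simp [BelowOnGrid, superpose_apply]
  rw [this]
  refine MeasurableSet.iInter fun i => MeasurableSet.iInter fun hi => ?_
  have h1 := hN i (hi.trans hj)
  have h2 := hNc i (hi.trans hj)
  exact measurableSet_lt (by fun_prop) measurable_const

theorem measurable_stepSum {f : Ω → CountingPath}
    (hN : ∀ i ≤ J, Measurable fun ω => N ω (i * mesh k))
    (hNc : ∀ i ≤ J, Measurable fun ω => Nc ω (i * mesh k))
    (hf : ∀ i ≤ J, Measurable fun ω => f ω (i * mesh k)) {j : ℕ} (hj : j ≤ J) :
    Measurable fun ω => (f ω).stepSum ((N ω).superpose (Nc ω)) S D k j := by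
  unfold stepSum
  refine Finset.measurable_fun_sum _ fun i hi => ?_
  have hi : i < j := Finset.mem_range.1 hi
  exact Measurable.ite (measurableSet_belowOnGrid hN hNc (by omega))
    ((hf _ (by omega)).sub (hf _ (by omega))) measurable_const

theorem measurable_gridBuffer (hN : ∀ i ≤ J, Measurable fun ω => N ω (i * mesh k))
    (hNc : ∀ i ≤ J, Measurable fun ω => Nc ω (i * mesh k)) {j : ℕ} (hj : j ≤ J) :
    Measurable fun ω => gridBuffer S D (N ω) (Nc ω) k j := by
  have h1 := hN j hj
  have h2 := measurable_stepSum (S := S) (D := D) hN hNc hNc hj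
  unfold gridBuffer
  fun_prop

end Measurability

theorem CountingPath.stepSum_succ_of_belowOnGrid (f : CountingPath) {m : CountingPath} {S D : ℝ}
    {k j : ℕ} (h : m.BelowOnGrid S D k j) :
    f.stepSum m S D k (j + 1) = f ((j + 1 : ℕ) * mesh k) := by
  rw [← sum_increment, stepSum]
  refine Finset.sum_congr rfl fun i hi => ?_
  have hi : i ≤ j := Nat.lt_succ_iff.1 (Finset.mem_range.1 hi)
  have hb : m.BelowOnGrid S D k i := fun l hl => h l (hl.trans hi)
  rw [if_pos hb, increment]

theorem gridBuffer_zero (S D : ℝ) (n nc : CountingPath) (k : ℕ) :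
    gridBuffer S D n nc k 0 = D := by
  simp [gridBuffer, stepSum, n.zero]

open Classical in
theorem gridBuffer_succ (S D : ℝ) (n nc : CountingPath) (k j : ℕ) :
    gridBuffer S D n nc k (j + 1) = gridBuffer S D n nc k j + n.increment (mesh k) j +
      (if (n.superpose nc).BelowOnGrid S D k j then (nc.increment (mesh k) j : ℝ) else 0) -
      mesh k := by
  rw [gridBuffer, gridBuffer, stepSum, Finset.sum_range_succ, ← stepSum,
    ← apply_add_increment n]
  simp only [increment]
  split_ifs <;> push_cast <;> ring

/-- The failure can only come from the point `j + 1`, and there the grid buffer still has all costly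
arrivals. -/
theorem le_gridBuffer_succ {S D : ℝ} {n nc : CountingPath} {k j : ℕ}
    (h : (n.superpose nc).BelowOnGrid S D k j)
    (h' : ¬ (n.superpose nc).BelowOnGrid S D k (j + 1)) :
    S - mesh k ≤ gridBuffer S D n nc k (j + 1) := by
  rw [gridBuffer, stepSum_succ_of_belowOnGrid nc h]
  by_contra! hlt
  refine h' fun i hi => ?_
  rcases Nat.le_succ_iff.1 hi with hi | rfl
  · exact h i hi
  · rw [superpose_apply]
    push_cast at hlt ⊢
    linarith

open Classical in
/-- The potential of the buffer process at the grid points: an upper bound for the probability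
of an interruption after that time. -/
noncomputable def gridPotential (α₀ α₁ S D : ℝ) (n nc : CountingPath) (k j : ℕ) : ℝ≥0∞ :=
  if (n.superpose nc).BelowOnGrid S D k j then
    ENNReal.ofReal (Real.exp (-(α₁ * gridBuffer S D n nc k j))) +
      ENNReal.ofReal (Real.exp (-(α₀ * (S - mesh k))))
  else ENNReal.ofReal (Real.exp (-(α₀ * gridBuffer S D n nc k j)))

theorem gridPotential_zero_le {α₀ : ℝ} (hα₀ : 0 ≤ α₀) (α₁ S D : ℝ) (n nc : CountingPath) (k : ℕ) :
    gridPotential α₀ α₁ S D n nc k 0 ≤ ENNReal.ofReal (Real.exp (-(α₁ * D))) +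
      ENNReal.ofReal (Real.exp (-(α₀ * (S - mesh k)))) := by
  rw [gridPotential, gridBuffer_zero]
  split_ifs with h
  · rfl
  · refine le_add_left (ENNReal.ofReal_le_ofReal (Real.exp_le_exp.2 ?_))
    have : S - mesh k ≤ D := by
      by_contra! hlt
      refine h fun i hi => ?_
      obtain rfl : i = 0 := by omega
      simpa [superpose_apply, n.zero, nc.zero] using hlt
    nlinarith

/-- Each branch contains some exp(-αᵢx) with x ≤ `mesh k`; the exponent with α₀ + α₁ serves both. -/
theorem le_gridPotential {α₀ α₁ : ℝ} (hα₀ : 0 ≤ α₀) (hα₁ : 0 ≤ α₁) {S D : ℝ}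
    {n nc : CountingPath} {k j : ℕ} (h : gridBuffer S D n nc k j ≤ mesh k) :
    ENNReal.ofReal (Real.exp (-((α₀ + α₁) * mesh k))) ≤ gridPotential α₀ α₁ S D n nc k j := by
  have hm : (0 : ℝ) ≤ mesh k := NNReal.coe_nonneg _
  rw [gridPotential]
  split_ifs
  · refine le_add_right (ENNReal.ofReal_le_ofReal (Real.exp_le_exp.2 ?_))
    nlinarith
  · refine ENNReal.ofReal_le_ofReal (Real.exp_le_exp.2 ?_)
    nlinarith

-- At the switch the new value exp(-α₀x) is at most the constant term, by `le_gridBuffer_succ`. The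
-- bound is written as history times increment so that independence applies.
open Classical in
theorem gridPotential_succ_le {α₀ : ℝ} (hα₀ : 0 ≤ α₀) (α₁ S D : ℝ) (n nc : CountingPath)
    (k j : ℕ) :
    gridPotential α₀ α₁ S D n nc k (j + 1) ≤
      if (n.superpose nc).BelowOnGrid S D k j then
        ENNReal.ofReal (Real.exp (-(α₁ * gridBuffer S D n nc k j))) *
          ENNReal.ofReal (Real.exp (-(α₁ *
            (((n.increment (mesh k) j + nc.increment (mesh k) j : ℕ) : ℝ) - mesh k)))) +
        ENNReal.ofReal (Real.exp (-(α₀ * (S - mesh k))))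
      else ENNReal.ofReal (Real.exp (-(α₀ * gridBuffer S D n nc k j))) *
        ENNReal.ofReal (Real.exp (-(α₀ * ((n.increment (mesh k) j : ℝ) - mesh k)))) := by
  have hs := gridBuffer_succ S D n nc k j
  by_cases h : (n.superpose nc).BelowOnGrid S D k j
  · rw [if_pos h] at hs ⊢
    by_cases h' : (n.superpose nc).BelowOnGrid S D k (j + 1)
    · rw [gridPotential, if_pos h', hs, ← ENNReal.ofReal_mul (Real.exp_pos _).le, ← Real.exp_add]
      gcongr
      push_cast
      linarith
    · rw [gridPotential, if_neg h']
      refine le_add_left (ENNReal.ofReal_le_ofReal (Real.exp_le_exp.2 ?_))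
      have := le_gridBuffer_succ h h'
      nlinarith
  · have h' : ¬ (n.superpose nc).BelowOnGrid S D k (j + 1) :=
      fun h' => h fun i hi => h' i (by omega)
    rw [if_neg h] at hs ⊢
    rw [gridPotential, if_neg h', hs, ← ENNReal.ofReal_mul (Real.exp_pos _).le, ← Real.exp_add]
    gcongr
    linarith

section GridProcess

variable {Ω : Type*} {mΩ : MeasurableSpace Ω} {μ : Measure Ω} [IsProbabilityMeasure μ]
  {R₀ Rc : ℝ≥0} {N Nc : Ω → CountingPath}

theorem measurable_gridPotential (α₀ α₁ S D : ℝ) (N Nc : Ω → CountingPath) (k : ℕ) {i j : ℕ}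
    (hij : i ≤ j) :
    Measurable[gridSigma N Nc (mesh k) j] fun ω => gridPotential α₀ α₁ S D (N ω) (Nc ω) k i := by
  have h1 := @measurable_gridBuffer Ω (gridSigma N Nc (mesh k) j) N Nc S D k j
    (fun _ h => measurable_gridSigma_left N Nc _ h)
    (fun _ h => measurable_gridSigma_right N Nc _ h) i hij
  have h2 := @measurableSet_belowOnGrid Ω (gridSigma N Nc (mesh k) j) N Nc S D k j
    (fun _ h => measurable_gridSigma_left N Nc _ h)
    (fun _ h => measurable_gridSigma_right N Nc _ h) i hij
  unfold gridPotential
  refine Measurable.ite h2 ?_ ?_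
  · exact (((h1.const_mul α₁).neg.exp).ennreal_ofReal).add measurable_const
  · exact ((h1.const_mul α₀).neg.exp).ennreal_ofReal

theorem IsPoissonProcess.setLIntegral_gridPotential_succ_le (hN : IsPoissonProcess μ R₀ N)
    (hNc : IsPoissonProcess μ Rc Nc)
    (hind : IndepFun (fun ω t => N ω t) (fun ω t => Nc ω t) μ) {α₀ α₁ : ℝ} (hα₀ : 0 ≤ α₀)
    (hr₀ : α₀ + R₀ * (Real.exp (-α₀) - 1) = 0)
    (hr₁ : α₁ + (R₀ + Rc : ℝ≥0) * (Real.exp (-α₁) - 1) = 0) (S D : ℝ) (k j : ℕ) {s : Set Ω}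
    (hs : MeasurableSet[gridSigma N Nc (mesh k) j] s) :
    ∫⁻ ω in s, gridPotential α₀ α₁ S D (N ω) (Nc ω) k (j + 1) ∂μ ≤
      ∫⁻ ω in s, gridPotential α₀ α₁ S D (N ω) (Nc ω) k j ∂μ := by
  have hle := hN.gridSigma_le hNc (mesh k) j
  have h1 := @measurable_gridBuffer Ω (gridSigma N Nc (mesh k) j) N Nc S D k j
    (fun _ h => measurable_gridSigma_left N Nc _ h)
    (fun _ h => measurable_gridSigma_right N Nc _ h) j le_rfl
  have h2 := @measurableSet_belowOnGrid Ω (gridSigma N Nc (mesh k) j) N Nc S D k j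
    (fun _ h => measurable_gridSigma_left N Nc _ h)
    (fun _ h => measurable_gridSigma_right N Nc _ h) j le_rfl
  set V : Set Ω := {ω | ((N ω).superpose (Nc ω)).BelowOnGrid S D k j} with hV
  -- The history factors before and after the switch and the constant term, cut to `s`. The
  -- increment factors `g₁` and `g₀` have mean 1 by the root equations.
  set F₁ : Ω → ℝ≥0∞ := (s ∩ V).indicator fun ω =>
    ENNReal.ofReal (Real.exp (-(α₁ * gridBuffer S D (N ω) (Nc ω) k j))) with hF₁
  set F₀ : Ω → ℝ≥0∞ := (s \ V).indicator fun ω =>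
    ENNReal.ofReal (Real.exp (-(α₀ * gridBuffer S D (N ω) (Nc ω) k j))) with hF₀
  set B : Ω → ℝ≥0∞ := (s ∩ V).indicator fun _ =>
    ENNReal.ofReal (Real.exp (-(α₀ * (S - mesh k)))) with hB
  set g₁ : ℕ → ℕ → ℝ≥0∞ := fun a b =>
    ENNReal.ofReal (Real.exp (-(α₁ * (((a + b : ℕ) : ℝ) - mesh k)))) with hg₁
  set g₀ : ℕ → ℕ → ℝ≥0∞ := fun a _ =>
    ENNReal.ofReal (Real.exp (-(α₀ * ((a : ℝ) - mesh k)))) with hg₀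
  have mF₁ : Measurable[gridSigma N Nc (mesh k) j] F₁ :=
    ((h1.const_mul α₁).neg.exp.ennreal_ofReal).indicator (hs.inter h2)
  have mF₀ : Measurable[gridSigma N Nc (mesh k) j] F₀ :=
    ((h1.const_mul α₀).neg.exp.ennreal_ofReal).indicator (hs.diff h2)
  have mB : Measurable B := measurable_const.indicator (hle _ (hs.inter h2))
  have mg : ∀ g : ℕ → ℕ → ℝ≥0∞, Measurable fun ω =>
      g ((N ω).increment (mesh k) j) ((Nc ω).increment (mesh k) j) := fun g =>
    (measurable_of_countable (Function.uncurry g)).comp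
      ((hN.measurable_increment _ j).prodMk (hNc.measurable_increment _ j))
  have i₁ : ∫⁻ ω, g₁ ((N ω).increment (mesh k) j) ((Nc ω).increment (mesh k) j) ∂μ = 1 := by
    rw [← lintegral_exp_of_hasLaw_poissonMeasure hr₁
      (hN.hasLaw_increment_superpose hNc hind (mesh k) j)]
    simp only [hg₁, increment_superpose]
  have i₀ : ∫⁻ ω, g₀ ((N ω).increment (mesh k) j) ((Nc ω).increment (mesh k) j) ∂μ = 1 :=
    lintegral_exp_of_hasLaw_poissonMeasure hr₀ (hN.hasLaw_increment (mesh k) j)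
  rw [← lintegral_indicator (hle _ hs), ← lintegral_indicator (hle _ hs)]
  calc ∫⁻ ω, s.indicator (fun ω => gridPotential α₀ α₁ S D (N ω) (Nc ω) k (j + 1)) ω ∂μ
      ≤ ∫⁻ ω, F₁ ω * g₁ ((N ω).increment (mesh k) j) ((Nc ω).increment (mesh k) j) + B ω +
          F₀ ω * g₀ ((N ω).increment (mesh k) j) ((Nc ω).increment (mesh k) j) ∂μ := by
        refine lintegral_mono fun ω => ?_
        have h := gridPotential_succ_le hα₀ α₁ S D (N ω) (Nc ω) k j
        by_cases hω : ω ∈ s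
        · by_cases hb : ((N ω).superpose (Nc ω)).BelowOnGrid S D k j
          · have e1 : ω ∈ s ∩ V := ⟨hω, hb⟩
            have e2 : ω ∉ s \ V := fun h' => h'.2 hb
            rw [if_pos hb] at h
            simpa [hF₁, hF₀, hB, Set.indicator_of_mem hω, Set.indicator_of_mem e1,
              Set.indicator_of_notMem e2, hg₁] using h
          · have e1 : ω ∉ s ∩ V := fun h' => hb h'.2
            have e2 : ω ∈ s \ V := ⟨hω, hb⟩
            rw [if_neg hb] at h
            simpa [hF₁, hF₀, hB, Set.indicator_of_mem hω, Set.indicator_of_mem e2,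
              Set.indicator_of_notMem e1, hg₀] using h
        · simp [Set.indicator_of_notMem hω]
    _ = ∫⁻ ω, F₁ ω + B ω + F₀ ω ∂μ := by
        have mF₁' := mF₁.mono hle le_rfl
        have mF₀' := mF₀.mono hle le_rfl
        rw [lintegral_add_right _ (mF₀'.fun_mul (mg g₀)), lintegral_add_right _ mB,
          lintegral_add_right _ mF₀', lintegral_add_right _ mB,
          hN.lintegral_mul_increment hNc hind _ _ mF₁,
          hN.lintegral_mul_increment hNc hind _ _ mF₀, i₁, i₀, mul_one, mul_one]
    _ = ∫⁻ ω, s.indicator (fun ω => gridPotential α₀ α₁ S D (N ω) (Nc ω) k j) ω ∂μ := by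
        refine lintegral_congr fun ω => ?_
        by_cases hω : ω ∈ s
        · by_cases hb : ((N ω).superpose (Nc ω)).BelowOnGrid S D k j
          · have e1 : ω ∈ s ∩ V := ⟨hω, hb⟩
            have e2 : ω ∉ s \ V := fun h' => h'.2 hb
            simp [hF₁, hF₀, hB, Set.indicator_of_mem hω, Set.indicator_of_mem e1,
              Set.indicator_of_notMem e2, gridPotential, hb]
          · have e1 : ω ∉ s ∩ V := fun h' => hb h'.2
            have e2 : ω ∈ s \ V := ⟨hω, hb⟩
            simp [hF₁, hF₀, hB, Set.indicator_of_mem hω, Set.indicator_of_mem e2,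
              Set.indicator_of_notMem e1, gridPotential, hb]
        · have e1 : ω ∉ s ∩ V := fun h' => hω h'.1
          have e2 : ω ∉ s \ V := fun h' => hω h'.1
          simp [hF₁, hF₀, hB, Set.indicator_of_notMem hω, Set.indicator_of_notMem e1,
              Set.indicator_of_notMem e2]

theorem IsPoissonProcess.measure_exists_gridBuffer_le (hN : IsPoissonProcess μ R₀ N)
    (hNc : IsPoissonProcess μ Rc Nc)
    (hind : IndepFun (fun ω t => N ω t) (fun ω t => Nc ω t) μ) {α₀ α₁ : ℝ} (hα₀ : 0 ≤ α₀)
    (hα₁ : 0 ≤ α₁) (hr₀ : α₀ + R₀ * (Real.exp (-α₀) - 1) = 0)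
    (hr₁ : α₁ + (R₀ + Rc : ℝ≥0) * (Real.exp (-α₁) - 1) = 0) (S D : ℝ) (k J : ℕ) :
    μ {ω | ∃ j ≤ J, gridBuffer S D (N ω) (Nc ω) k j ≤ mesh k} ≤
      ENNReal.ofReal (Real.exp ((α₀ + α₁) * mesh k) *
        (Real.exp (-(α₁ * D)) + Real.exp (-(α₀ * (S - mesh k))))) := by
  have h := mul_measure_exists_le_of_setLIntegral_le (μ := μ)
    (ENNReal.ofReal (Real.exp (-((α₀ + α₁) * mesh k))))
    (fun j ω => gridPotential α₀ α₁ S D (N ω) (Nc ω) k j) (gridSigma N Nc (mesh k))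
    (hN.gridSigma_le hNc _) (fun i j hij => measurable_gridPotential _ _ _ _ _ _ _ hij)
    (fun j s hs => hN.setLIntegral_gridPotential_succ_le hNc hind hα₀ hr₀ hr₁ S D k j hs) J
  have h0 : ∫⁻ ω, gridPotential α₀ α₁ S D (N ω) (Nc ω) k 0 ∂μ ≤
      ENNReal.ofReal (Real.exp (-(α₁ * D)) + Real.exp (-(α₀ * (S - mesh k)))) := by
    rw [ENNReal.ofReal_add (Real.exp_pos _).le (Real.exp_pos _).le]
    refine (lintegral_mono fun ω => gridPotential_zero_le hα₀ α₁ S D (N ω) (Nc ω) k).trans ?_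
    simp
  have e : ENNReal.ofReal (Real.exp ((α₀ + α₁) * mesh k)) *
      ENNReal.ofReal (Real.exp (-((α₀ + α₁) * mesh k))) = 1 := by
    rw [← ENNReal.ofReal_mul (Real.exp_pos _).le, ← Real.exp_add]
    simp
  calc μ {ω | ∃ j ≤ J, gridBuffer S D (N ω) (Nc ω) k j ≤ mesh k}
      = ENNReal.ofReal (Real.exp ((α₀ + α₁) * mesh k)) *
          (ENNReal.ofReal (Real.exp (-((α₀ + α₁) * mesh k))) *
            μ {ω | ∃ j ≤ J, gridBuffer S D (N ω) (Nc ω) k j ≤ mesh k}) := by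
        rw [← mul_assoc, e, one_mul]
    _ ≤ ENNReal.ofReal (Real.exp ((α₀ + α₁) * mesh k)) *
          (ENNReal.ofReal (Real.exp (-(α₁ * D)) + Real.exp (-(α₀ * (S - mesh k))))) := by
        gcongr
        refine le_trans ?_ (h.trans h0)
        refine mul_le_mul_right (measure_mono ?_) _
        exact fun ω ⟨j, hj, hx⟩ => ⟨j, hj, le_gridPotential hα₀ hα₁ hx⟩
    _ = _ := by rw [ENNReal.ofReal_mul (Real.exp_pos _).le]

/-- The interruption probability of the safe policy with threshold `S`. -/
theorem IsPoissonProcess.measure_exists_safeBuffer_le (hN : IsPoissonProcess μ R₀ N)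
    (hNc : IsPoissonProcess μ Rc Nc)
    (hind : IndepFun (fun ω t => N ω t) (fun ω t => Nc ω t) μ) {α₀ α₁ : ℝ} (hα₀ : 0 ≤ α₀)
    (hα₁ : 0 ≤ α₁) (hr₀ : α₀ + R₀ * (Real.exp (-α₀) - 1) = 0)
    (hr₁ : α₁ + (R₀ + Rc : ℝ≥0) * (Real.exp (-α₁) - 1) = 0) (S D : ℝ) :
    μ {ω | ∃ t, safeBuffer S D (N ω) (Nc ω) t ≤ 0} ≤
      ENNReal.ofReal (Real.exp (-(α₁ * D)) + Real.exp (-(α₀ * S))) := by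
  have hlim : Filter.Tendsto (fun k => ENNReal.ofReal (Real.exp ((α₀ + α₁) * mesh k) *
        (Real.exp (-(α₁ * D)) + Real.exp (-(α₀ * (S - mesh k)))))) Filter.atTop
      (nhds (ENNReal.ofReal (Real.exp (-(α₁ * D)) + Real.exp (-(α₀ * S))))) := by
    have hc : Continuous fun h : ℝ => ENNReal.ofReal (Real.exp ((α₀ + α₁) * h) *
        (Real.exp (-(α₁ * D)) + Real.exp (-(α₀ * (S - h))))) :=
      ENNReal.continuous_ofReal.comp (by fun_prop)
    have := (hc.tendsto 0).comp tendsto_mesh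
    simpa [Function.comp_def] using this
  have hT : ∀ T : ℕ, μ {ω | ∃ t ≤ (T : ℝ≥0), safeBuffer S D (N ω) (Nc ω) t ≤ 0} ≤
      ENNReal.ofReal (Real.exp (-(α₁ * D)) + Real.exp (-(α₀ * S))) := by
    intro T
    set A : ℕ → Set Ω := fun k =>
      {ω | ∃ j ≤ T * (k + 1), gridBuffer S D (N ω) (Nc ω) k j ≤ mesh k} with hA
    -- How fine the mesh must be depends on the path, so the event is placed in the lower limit of
    -- the grid events. Continuity from below then passes the uniform bound to the limit, without
    -- measurability of these sets.
    have hsub : {ω | ∃ t ≤ (T : ℝ≥0), safeBuffer S D (N ω) (Nc ω) t ≤ 0} ⊆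
        ⋃ K, ⋂ k, ⋂ (_ : K ≤ k), A k := by
      rintro ω ⟨t, ht, hx⟩
      obtain ⟨K, hK⟩ := Filter.eventually_atTop.1 (eventually_gridBuffer_le ht hx)
      simp only [Set.mem_iUnion, Set.mem_iInter]
      exact ⟨K, hK⟩
    refine (measure_mono hsub).trans ?_
    have hmono : Monotone fun K => ⋂ k, ⋂ (_ : K ≤ k), A k := fun a b hab =>
      Set.iInter_mono fun k => Set.iInter_mono' fun h => ⟨hab.trans h, le_rfl⟩
    rw [hmono.measure_iUnion]
    refine iSup_le fun K => ge_of_tendsto hlim ?_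
    filter_upwards [Filter.eventually_ge_atTop K] with k hk
    exact (measure_mono (Set.iInter₂_subset k hk)).trans
      (hN.measure_exists_gridBuffer_le hNc hind hα₀ hα₁ hr₀ hr₁ S D k _)
  have hU : {ω | ∃ t, safeBuffer S D (N ω) (Nc ω) t ≤ 0} =
      ⋃ T : ℕ, {ω | ∃ t ≤ (T : ℝ≥0), safeBuffer S D (N ω) (Nc ω) t ≤ 0} := by
    ext ω
    simp only [Set.mem_ofPred_eq, Set.mem_iUnion]
    constructor
    · rintro ⟨t, ht⟩
      obtain ⟨T, hT⟩ := exists_nat_ge t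
      exact ⟨T, t, hT, ht⟩
    · rintro ⟨_, t, _, ht⟩
      exact ⟨t, ht⟩
  have hmono : Monotone fun T : ℕ =>
      {ω | ∃ t ≤ (T : ℝ≥0), safeBuffer S D (N ω) (Nc ω) t ≤ 0} :=
    fun a b hab ω ⟨t, ht, hx⟩ => ⟨t, ht.trans (by exact_mod_cast hab), hx⟩
  rw [hU, hmono.measure_iUnion]
  exact iSup_le hT

end GridProcess

/-! ### Unit jumps and Wald's identity. -/

namespace CountingPath

/-- All jumps of the counting path have size one. -/
def HasUnitJumps (m : CountingPath) : Prop := ∀ t, 0 < t → ∃ s < t, m t ≤ m s + 1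

theorem HasUnitJumps.lt_add_one {m : CountingPath} (hm : m.HasUnitJumps) {S D : ℝ} (hSD : D < S)
    {τ : ℝ≥0} (h : (τ : ℝ≥0∞) ≤ m.exitTime S D) : D + m τ - τ < S + 1 := by
  rcases eq_zero_or_pos τ with rfl | hτ
  · simp [m.zero]
    linarith
  · obtain ⟨s, hs, hms⟩ := hm τ hτ
    have h1 := (m.le_exitTime_iff S D τ).1 h s hs
    have h2 : (m τ : ℝ) ≤ m s + 1 := by exact_mod_cast hms
    have h3 : (s : ℝ) < τ := hs
    linarith

/-- A jump of size at least two at t shows in the interval (jh, (j + 1)h] containing t, at every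
mesh h. -/
theorem exists_two_le_increment {m : CountingPath} {t : ℝ≥0} (ht : 0 < t)
    (hm : ∀ s < t, m s + 1 < m t) {T : ℕ} (hT : t ≤ T) (k : ℕ) :
    ∃ j < T * (k + 1), 2 ≤ m.increment (mesh k) j := by
  have hpos := mesh_pos k
  obtain ⟨j, hj⟩ : ∃ j, ⌈t / mesh k⌉₊ = j + 1 :=
    Nat.exists_eq_add_one.2 (Nat.ceil_pos.2 (div_pos ht hpos))
  have h1 : t ≤ (j + 1 : ℕ) * mesh k := by
    rw [← div_le_iff₀ hpos, ← hj]; exact Nat.le_ceil _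
  have h2 : j * mesh k < t := by
    rw [← lt_div_iff₀ hpos, ← Nat.lt_ceil, hj]; exact Nat.lt_succ_self j
  have h3 : j < T * (k + 1) := by
    have : (j : ℝ≥0) * mesh k < T * (k + 1) * mesh k := by
      rw [natCast_mul_succ_mul_mesh]; exact h2.trans_le hT
    exact_mod_cast lt_of_mul_lt_mul_right this hpos.le
  refine ⟨j, h3, ?_⟩
  have h4 := hm _ h2
  have h5 := m.mono h1
  rw [increment]
  omega

theorem stepSum_le (f m : CountingPath) (S D : ℝ) (k J : ℕ) :
    f.stepSum m S D k J ≤ f (J * mesh k) := by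
  rw [← sum_increment, stepSum]
  refine Finset.sum_le_sum fun i _ => ?_
  rw [increment]
  split_ifs <;> simp

end CountingPath

section GridProcess

variable {Ω : Type*} {mΩ : MeasurableSpace Ω} {μ : Measure Ω} {R₀ Rc : ℝ≥0}
  {N Nc : Ω → CountingPath}

namespace IsPoissonProcess

theorem ae_hasUnitJumps_superpose (hN : IsPoissonProcess μ R₀ N) (hNc : IsPoissonProcess μ Rc Nc)
    (hind : IndepFun (fun ω t => N ω t) (fun ω t => Nc ω t) μ) :
    ∀ᵐ ω ∂μ, ((N ω).superpose (Nc ω)).HasUnitJumps := by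
  set m : Ω → CountingPath := fun ω => (N ω).superpose (Nc ω) with hm
  have hT : ∀ T : ℕ, ∀ᵐ ω ∂μ, ¬ ∃ t, 0 < t ∧ t ≤ (T : ℝ≥0) ∧ ∀ s < t, m ω s + 1 < m ω t := by
    intro T
    rw [ae_iff]
    simp only [not_not]
    -- Union bound: T(k + 1) intervals, each with probability at most (R₁h)² for h = 1/(k + 1), give
    -- TR₁²h, which tends to 0.
    have hb : ∀ k : ℕ, μ {ω | ∃ t, 0 < t ∧ t ≤ (T : ℝ≥0) ∧ ∀ s < t, m ω s + 1 < m ω t} ≤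
        ENNReal.ofReal (T * ((R₀ + Rc) ^ 2 * mesh k)) := by
      intro k
      have hsub : {ω | ∃ t, 0 < t ∧ t ≤ (T : ℝ≥0) ∧ ∀ s < t, m ω s + 1 < m ω t} ⊆
          ⋃ j ∈ Finset.range (T * (k + 1)), {ω | 2 ≤ (m ω).increment (mesh k) j} := by
        rintro ω ⟨t, ht, htT, hs⟩
        obtain ⟨j, hj, h2⟩ := exists_two_le_increment ht hs htT k
        simp only [Set.mem_iUnion, Finset.mem_range]
        exact ⟨j, hj, h2⟩
      have hj : ∀ j, μ {ω | 2 ≤ (m ω).increment (mesh k) j} ≤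
          (((R₀ + Rc) * mesh k : ℝ≥0) : ℝ≥0∞) ^ 2 := by
        intro j
        have hl := hN.hasLaw_increment_superpose hNc hind (mesh k) j
        refine le_trans (le_of_eq ?_) (poissonMeasure_two_le ((R₀ + Rc) * mesh k))
        rw [← hl.map_eq, Measure.map_apply_of_aemeasurable hl.aemeasurable .of_discrete]
        rfl
      refine (measure_mono hsub).trans ((measure_biUnion_finset_le _ _).trans
        ((Finset.sum_le_sum fun j _ => hj j).trans (le_of_eq ?_)))
      rw [Finset.sum_const, Finset.card_range, nsmul_eq_mul]
      have e : (T : ℝ) * ((R₀ + Rc) ^ 2 * mesh k) =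
          (((T : ℝ≥0) * ((R₀ + Rc) ^ 2 * mesh k) : ℝ≥0) : ℝ) := by push_cast; rfl
      rw [e, ENNReal.ofReal_coe_nnreal]
      norm_cast
      rw [mul_pow]
      push_cast
      have := natCast_mul_succ_mul_mesh T k
      linear_combination (R₀ + Rc) ^ 2 * mesh k * this
    have hlim : Filter.Tendsto (fun k => ENNReal.ofReal (T * ((R₀ + Rc) ^ 2 * mesh k)))
        Filter.atTop (nhds 0) := by
      have := ENNReal.tendsto_ofReal
        ((tendsto_mesh.const_mul (((R₀ : ℝ) + Rc) ^ 2)).const_mul (T : ℝ))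
      simpa using this
    exact le_antisymm (ge_of_tendsto' hlim hb) zero_le
  filter_upwards [ae_all_iff.2 hT] with ω hω t ht
  by_contra! h
  obtain ⟨T, hT⟩ := exists_nat_ge t
  exact hω T ⟨t, ht, hT, h⟩

theorem lintegral_superpose (hN : IsPoissonProcess μ R₀ N) (hNc : IsPoissonProcess μ Rc Nc)
    (hind : IndepFun (fun ω t => N ω t) (fun ω t => Nc ω t) μ) (T : ℝ≥0) :
    ∫⁻ ω, ((N ω).superpose (Nc ω) T : ℝ≥0∞) ∂μ = ((R₀ + Rc) * T : ℝ≥0) := by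
  have hl := hN.hasLaw_increment_superpose hNc hind T 0
  have := lintegral_of_hasLaw_poissonMeasure hl (fun n => (n : ℝ≥0∞))
  rw [lintegral_natCast_poissonMeasure] at this
  rw [← this]
  simp [increment, CountingPath.zero]

theorem measurable_stepSum_superpose (hN : IsPoissonProcess μ R₀ N)
    (hNc : IsPoissonProcess μ Rc Nc) (S D : ℝ) (k J : ℕ) :
    Measurable fun ω => ((N ω).superpose (Nc ω)).stepSum ((N ω).superpose (Nc ω)) S D k J :=
  measurable_stepSum (J := J) (fun _ _ => hN.measurable _) (fun _ _ => hNc.measurable _)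
    (fun _ _ => (hN.measurable _).add (hNc.measurable _)) le_rfl

variable [IsProbabilityMeasure μ]

open Classical in
/-- Wald's identity on a grid. -/
theorem lintegral_stepSum (hN : IsPoissonProcess μ R₀ N) (hNc : IsPoissonProcess μ Rc Nc)
    (hind : IndepFun (fun ω t => N ω t) (fun ω t => Nc ω t) μ) (S D : ℝ) (k J : ℕ) :
    ∫⁻ ω, (((N ω).superpose (Nc ω)).stepSum ((N ω).superpose (Nc ω)) S D k J : ℝ≥0∞) ∂μ =
      (R₀ + Rc : ℝ≥0) * ∫⁻ ω, ((∑ j ∈ Finset.range J,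
        if ((N ω).superpose (Nc ω)).BelowOnGrid S D k j then mesh k else 0 : ℝ≥0) : ℝ≥0∞) ∂μ := by
  have hV : ∀ j, MeasurableSet[gridSigma N Nc (mesh k) j]
      {ω | ((N ω).superpose (Nc ω)).BelowOnGrid S D k j} := fun j =>
    @measurableSet_belowOnGrid Ω (gridSigma N Nc (mesh k) j) N Nc S D k j
      (fun _ h => measurable_gridSigma_left N Nc _ h)
      (fun _ h => measurable_gridSigma_right N Nc _ h) j le_rfl
  set F : ℕ → Ω → ℝ≥0∞ := fun j ω =>
    if ((N ω).superpose (Nc ω)).BelowOnGrid S D k j then 1 else 0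
  have hF : ∀ j, Measurable[gridSigma N Nc (mesh k) j] (F j) := fun j =>
    Measurable.ite (hV j) measurable_const measurable_const
  have hF' : ∀ j, Measurable (F j) := fun j => (hF j).mono (hN.gridSigma_le hNc _ j) le_rfl
  have hi : ∀ j, Measurable fun ω =>
      ((((N ω).increment (mesh k) j + (Nc ω).increment (mesh k) j : ℕ)) : ℝ≥0∞) := fun j => by
    have h1 := hN.measurable_increment (mesh k) j
    have h2 := hNc.measurable_increment (mesh k) j
    fun_prop
  have e1 : ∀ ω, (((N ω).superpose (Nc ω)).stepSum ((N ω).superpose (Nc ω)) S D k J : ℝ≥0∞) =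
      ∑ j ∈ Finset.range J, F j ω *
        ((((N ω).increment (mesh k) j + (Nc ω).increment (mesh k) j : ℕ)) : ℝ≥0∞) := by
    intro ω
    rw [stepSum, Nat.cast_sum]
    refine Finset.sum_congr rfl fun j _ => ?_
    rw [← increment_superpose, increment]
    simp only [F]
    split_ifs <;> simp
  have e2 : ∀ ω, ((∑ j ∈ Finset.range J,
      if ((N ω).superpose (Nc ω)).BelowOnGrid S D k j then mesh k else 0 : ℝ≥0) : ℝ≥0∞) =
      ∑ j ∈ Finset.range J, F j ω * mesh k := by
    intro ω
    rw [ENNReal.ofNNReal_finsetSum]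
    refine Finset.sum_congr rfl fun j _ => ?_
    simp only [F]
    split_ifs <;> simp
  simp_rw [e1, e2]
  rw [lintegral_finsetSum _ fun j _ => (hF' j).fun_mul (hi j),
    lintegral_finsetSum _ fun j _ => (hF' j).fun_mul measurable_const, Finset.mul_sum]
  refine Finset.sum_congr rfl fun j _ => ?_
  -- Whether interval j is counted is decided by the history at its left end, so it is independent
  -- of the increment over it.
  rw [hN.lintegral_mul_increment hNc hind _ _ (hF j) (fun a b => ((a + b : ℕ) : ℝ≥0∞)),
    lintegral_mul_const _ (hF' j)]
  have hl := lintegral_of_hasLaw_poissonMeasure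
    (hN.hasLaw_increment_superpose hNc hind (mesh k) j) (fun n => (n : ℝ≥0∞))
  rw [lintegral_natCast_poissonMeasure] at hl
  simp only [increment_superpose] at hl
  rw [hl]
  push_cast
  ring

end IsPoissonProcess

theorem tendsto_stepSum (m : CountingPath) (S D : ℝ) (T : ℕ) :
    Filter.Tendsto (fun k => (m.stepSum m S D k (T * (k + 1)) : ℝ≥0∞)) Filter.atTop
      (nhds (m (cap T (m.exitTime S D)))) := by
  refine tendsto_const_nhds.congr' ?_
  filter_upwards [m.eventually_stepSum_eq m S D T] with k hk
  have e : ((T * (k + 1) : ℕ) : ℝ≥0) * mesh k = T := by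
    push_cast
    exact natCast_mul_succ_mul_mesh T k
  rw [hk _ e.le, e]

open Classical in
theorem tendsto_sum_mesh (m : CountingPath) (S D : ℝ) (T : ℕ) :
    Filter.Tendsto (fun k => ((∑ j ∈ Finset.range (T * (k + 1)),
        if m.BelowOnGrid S D k j then mesh k else 0 : ℝ≥0) : ℝ≥0∞)) Filter.atTop
      (nhds (cap T (m.exitTime S D))) := by
  rw [ENNReal.tendsto_coe]
  have hm : Filter.Tendsto mesh Filter.atTop (nhds 0) := by
    rw [← NNReal.tendsto_coe]
    exact tendsto_mesh
  have hu : Filter.Tendsto (fun k => cap T (m.exitTime S D) + mesh k) Filter.atTop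
      (nhds (cap T (m.exitTime S D))) := by
    simpa using hm.const_add (cap T (m.exitTime S D))
  have h : ∀ᶠ k in Filter.atTop, cap T (m.exitTime S D) ≤ ∑ j ∈ Finset.range (T * (k + 1)),
        (if m.BelowOnGrid S D k j then mesh k else 0) ∧
      ∑ j ∈ Finset.range (T * (k + 1)), (if m.BelowOnGrid S D k j then mesh k else 0) ≤
        cap T (m.exitTime S D) + mesh k := by
    filter_upwards [m.eventually_sum_mesh S D T] with k hk
    have e : ((T * (k + 1) : ℕ) : ℝ≥0) * mesh k = T := by
      push_cast
      exact natCast_mul_succ_mul_mesh T k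
    have := hk _ e.le
    rwa [e] at this
  exact tendsto_of_tendsto_of_tendsto_of_le_of_le' tendsto_const_nhds hu
    (h.mono fun _ h => h.1) (h.mono fun _ h => h.2)

namespace IsPoissonProcess

/-- The exit time is an infimum over uncountably many times; measurability comes from the grid
approximations. -/
theorem measurable_apply_cap (hN : IsPoissonProcess μ R₀ N) (hNc : IsPoissonProcess μ Rc Nc)
    (S D : ℝ) (T : ℕ) : Measurable fun ω => ((N ω).superpose (Nc ω)
      (cap T (((N ω).superpose (Nc ω)).exitTime S D)) : ℝ≥0∞) := by
  refine measurable_of_tendsto_metrizable (fun k => ?_)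
    (tendsto_pi_nhds.2 fun ω => tendsto_stepSum ((N ω).superpose (Nc ω)) S D T)
  have := hN.measurable_stepSum_superpose hNc S D k (T * (k + 1))
  fun_prop

open Classical in
theorem measurable_sum_mesh (hN : IsPoissonProcess μ R₀ N) (hNc : IsPoissonProcess μ Rc Nc)
    (S D : ℝ) (k J : ℕ) : Measurable fun ω => ((∑ j ∈ Finset.range J,
        if ((N ω).superpose (Nc ω)).BelowOnGrid S D k j then mesh k else 0 : ℝ≥0) : ℝ≥0∞) := by
  refine Measurable.coe_nnreal_ennreal (Finset.measurable_fun_sum _ fun j _ => ?_)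
  exact Measurable.ite (measurableSet_belowOnGrid (J := j) (fun _ _ => hN.measurable _)
    (fun _ _ => hNc.measurable _) le_rfl) measurable_const measurable_const

theorem measurable_cap (hN : IsPoissonProcess μ R₀ N) (hNc : IsPoissonProcess μ Rc Nc)
    (S D : ℝ) (T : ℕ) : Measurable fun ω =>
      (cap T (((N ω).superpose (Nc ω)).exitTime S D) : ℝ≥0∞) :=
  measurable_of_tendsto_metrizable (fun k => hN.measurable_sum_mesh hNc S D k (T * (k + 1)))
    (tendsto_pi_nhds.2 fun ω => tendsto_sum_mesh ((N ω).superpose (Nc ω)) S D T)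

variable [IsProbabilityMeasure μ]

/-- Wald's identity at the exit time capped at `T`. -/
theorem lintegral_apply_cap (hN : IsPoissonProcess μ R₀ N) (hNc : IsPoissonProcess μ Rc Nc)
    (hind : IndepFun (fun ω t => N ω t) (fun ω t => Nc ω t) μ) (S D : ℝ) (T : ℕ) :
    ∫⁻ ω, ((N ω).superpose (Nc ω)
        (cap T (((N ω).superpose (Nc ω)).exitTime S D)) : ℝ≥0∞) ∂μ =
      (R₀ + Rc : ℝ≥0) * ∫⁻ ω, (cap T (((N ω).superpose (Nc ω)).exitTime S D) : ℝ≥0∞) ∂μ := by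
  classical
  -- The step sums are dominated by the integrable `m T`, and the time sums by the constant T.
  have h1 := tendsto_lintegral_of_dominated_convergence (μ := μ)
    (fun ω => ((N ω).superpose (Nc ω) T : ℝ≥0∞))
    (fun k => measurable_from_top.comp
      (hN.measurable_stepSum_superpose hNc S D k (T * (k + 1)))) (fun k => ae_of_all _ fun ω => ?_)
    (by rw [hN.lintegral_superpose hNc hind]; exact ENNReal.coe_ne_top)
    (ae_of_all _ fun ω => tendsto_stepSum ((N ω).superpose (Nc ω)) S D T)
  · have h2 := tendsto_lintegral_of_dominated_convergence (μ := μ) (fun _ => (T : ℝ≥0∞))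
      (fun k => hN.measurable_sum_mesh hNc S D k (T * (k + 1)))
      (fun k => ae_of_all _ fun ω => ?_) (by simp)
      (ae_of_all _ fun ω => tendsto_sum_mesh ((N ω).superpose (Nc ω)) S D T)
    · refine tendsto_nhds_unique h1 ?_
      have h3 := ENNReal.Tendsto.const_mul h2
        (Or.inr (ENNReal.coe_ne_top : ((R₀ + Rc : ℝ≥0) : ℝ≥0∞) ≠ ⊤))
      refine h3.congr fun k => ?_
      rw [← hN.lintegral_stepSum hNc hind S D k (T * (k + 1))]
      rfl
    · have hle : ∑ j ∈ Finset.range (T * (k + 1)),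
          (if ((N ω).superpose (Nc ω)).BelowOnGrid S D k j then mesh k else 0) ≤ (T : ℝ≥0) := by
        refine (Finset.sum_le_sum (g := fun _ => mesh k) fun j _ => ?_).trans ?_
        · split_ifs <;> simp
        · rw [Finset.sum_const, Finset.card_range, nsmul_eq_mul]
          push_cast
          rw [natCast_mul_succ_mul_mesh]
      refine le_trans (ENNReal.coe_le_coe.2 hle) (by simp)
  · have := stepSum_le ((N ω).superpose (Nc ω)) ((N ω).superpose (Nc ω)) S D k (T * (k + 1))
    push_cast at this
    rw [natCast_mul_succ_mul_mesh] at this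
    exact Nat.cast_le.2 this

end IsPoissonProcess

end GridProcess

/-! ### The expected exit time. -/

theorem CountingPath.monotone_cap (e : ℝ≥0∞) : Monotone fun T : ℕ => cap T e := by
  intro a b hab
  exact le_cap_iff.2 ⟨(cap_le _ _).trans (by exact_mod_cast hab), (le_cap_iff.1 le_rfl).2⟩

theorem CountingPath.iSup_cap (e : ℝ≥0∞) : ⨆ T : ℕ, (cap T e : ℝ≥0∞) = e := by
  simp_rw [coe_cap, ENNReal.coe_natCast, ← iSup_inf_eq]
  rw [ENNReal.iSup_natCast, top_inf_eq]

theorem CountingPath.iSup_apply_cap (m : CountingPath) (τ : ℝ≥0) :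
    ⨆ T : ℕ, (m (cap T τ) : ℝ≥0∞) = m τ := by
  refine le_antisymm (iSup_le fun T => Nat.cast_le.2 (m.mono ?_)) ?_
  · exact_mod_cast (le_cap_iff.1 le_rfl : cap T τ ≤ T ∧ (cap T τ : ℝ≥0∞) ≤ τ).2
  · obtain ⟨T, hT⟩ := exists_nat_ge τ
    refine le_iSup_of_le T ?_
    rw [cap_coe_eq_right hT]

/-- The expected exit time of the superposition of two independent Poisson processes. -/
theorem IsPoissonProcess.exists_lintegral_exitTime_eq {Ω : Type*} {mΩ : MeasurableSpace Ω}
    {μ : Measure Ω} [IsProbabilityMeasure μ] {R₀ Rc : ℝ≥0} {N Nc : Ω → CountingPath}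
    (hN : IsPoissonProcess μ R₀ N) (hNc : IsPoissonProcess μ Rc Nc)
    (hind : IndepFun (fun ω t => N ω t) (fun ω t => Nc ω t) μ)
    (hR : 1 < (R₀ : ℝ) + Rc) {S D : ℝ} (hSD : D < S) :
    ∫⁻ ω, ((N ω).superpose (Nc ω)).exitTime S D ∂μ ≠ ⊤ ∧
      ∃ ξ : ℝ, 0 ≤ ξ ∧ ξ < 1 ∧
        (∫⁻ ω, ((N ω).superpose (Nc ω)).exitTime S D ∂μ).toReal =
          1 / ((R₀ : ℝ) + Rc - 1) * (S - D + ξ) := by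
  set m : Ω → CountingPath := fun ω => (N ω).superpose (Nc ω) with hm
  set e : Ω → ℝ≥0∞ := fun ω => (m ω).exitTime S D with he
  have hms : ∀ T : ℕ, Measurable fun ω => (cap T (e ω) : ℝ≥0∞) := hN.measurable_cap hNc S D
  have hmm : ∀ T : ℕ, Measurable fun ω => (m ω (cap T (e ω)) : ℝ≥0∞) :=
    hN.measurable_apply_cap hNc S D
  have hwald : ∀ T : ℕ, ∫⁻ ω, (m ω (cap T (e ω)) : ℝ≥0∞) ∂μ =
      (R₀ + Rc : ℝ≥0) * ∫⁻ ω, (cap T (e ω) : ℝ≥0∞) ∂μ := hN.lintegral_apply_cap hNc hind S D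
  have hjump : ∀ᵐ ω ∂μ, (m ω).HasUnitJumps := hN.ae_hasUnitJumps_superpose hNc hind
  have hR' : 0 < (R₀ : ℝ) + Rc - 1 := by linarith
  -- Capping at T makes both means finite, so Wald's identity and the overshoot bound D + m - t < S
  -- + 1 can be solved for the mean, uniformly in T.
  have hbound : ∀ T : ℕ, ∫⁻ ω, (cap T (e ω) : ℝ≥0∞) ∂μ ≤
      ENNReal.ofReal ((S + 1 - D) / ((R₀ : ℝ) + Rc - 1)) := by
    intro T
    have hfin : ∫⁻ ω, (cap T (e ω) : ℝ≥0∞) ∂μ ≠ ⊤ := by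
      refine ne_top_of_le_ne_top (b := (T : ℝ≥0∞)) (by simp) ?_
      refine (lintegral_mono fun ω => (?_ : _ ≤ (T : ℝ≥0∞))).trans (by simp)
      exact_mod_cast cap_le (T : ℝ≥0) (e ω)
    have hle : (R₀ + Rc : ℝ≥0) * ∫⁻ ω, (cap T (e ω) : ℝ≥0∞) ∂μ ≤
        ENNReal.ofReal (S + 1 - D) + ∫⁻ ω, (cap T (e ω) : ℝ≥0∞) ∂μ := by
      have : ENNReal.ofReal (S + 1 - D) + ∫⁻ ω, (cap T (e ω) : ℝ≥0∞) ∂μ =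
          ∫⁻ ω, ENNReal.ofReal (S + 1 - D) + (cap T (e ω) : ℝ≥0∞) ∂μ := by
        rw [lintegral_add_left measurable_const]
        simp
      rw [← hwald, this]
      refine lintegral_mono_ae ?_
      filter_upwards [hjump] with ω hω
      have h := hω.lt_add_one hSD (τ := cap T (e ω)) (le_cap_iff.1 le_rfl).2
      rw [← ENNReal.ofReal_natCast, ← ENNReal.ofReal_coe_nnreal,
        ← ENNReal.ofReal_add (by linarith) (by positivity)]
      exact ENNReal.ofReal_le_ofReal (by linarith)
    lift ∫⁻ ω, (cap T (e ω) : ℝ≥0∞) ∂μ to ℝ≥0 using hfin with a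
    rw [← ENNReal.ofReal_coe_nnreal (p := a)] at hle ⊢
    rw [← ENNReal.ofReal_coe_nnreal (p := R₀ + Rc), ← ENNReal.ofReal_mul (by positivity),
      ← ENNReal.ofReal_add (by linarith) (by positivity),
      ENNReal.ofReal_le_ofReal_iff (by have := NNReal.coe_nonneg a; linarith)] at hle
    refine ENNReal.ofReal_le_ofReal ?_
    rw [le_div_iff₀ hR']
    push_cast at hle
    linarith
  have heq : (fun ω => ⨆ T : ℕ, (cap T (e ω) : ℝ≥0∞)) = e := by
    ext ω; exact iSup_cap (e ω)
  have hme : Measurable e := by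
    rw [← heq]; exact Measurable.iSup hms
  have hE : ∫⁻ ω, e ω ∂μ = ⨆ T : ℕ, ∫⁻ ω, (cap T (e ω) : ℝ≥0∞) ∂μ := by
    rw [← lintegral_iSup hms fun a b hab ω => ENNReal.coe_le_coe.2 (monotone_cap (e ω) hab)]
    exact lintegral_congr fun ω => (congrFun heq ω).symm
  have hEfin : ∫⁻ ω, e ω ∂μ ≠ ⊤ := by
    rw [hE]
    exact ne_top_of_le_ne_top ENNReal.ofReal_ne_top (iSup_le hbound)
  -- `M` is the count at the exit time, written as a supremum so that it is defined and measurable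
  -- even where the exit time is infinite.
  set M : Ω → ℝ≥0∞ := fun ω => ⨆ T : ℕ, (m ω (cap T (e ω)) : ℝ≥0∞) with hM
  have hmM : Measurable M := Measurable.iSup hmm
  have hEM : ∫⁻ ω, M ω ∂μ = (R₀ + Rc : ℝ≥0) * ∫⁻ ω, e ω ∂μ := by
    rw [lintegral_iSup hmm fun a b hab ω =>
      Nat.cast_le.2 ((m ω).mono (monotone_cap (e ω) hab)), hE, ENNReal.mul_iSup]
    simp_rw [hwald]
  have hM' : ∀ᵐ ω ∂μ, ENNReal.ofReal (S - D) + e ω ≤ M ω ∧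
      M ω < ENNReal.ofReal (S - D) + e ω + 1 := by
    filter_upwards [hjump, ae_lt_top hme hEfin] with ω hω hlt
    obtain ⟨τ, hτ⟩ : ∃ τ : ℝ≥0, e ω = τ := ⟨(e ω).toNNReal, (ENNReal.coe_toNNReal hlt.ne).symm⟩
    have h1 : S ≤ D + m ω τ - τ := le_of_exitTime_eq hτ
    have h2 : D + m ω τ - τ < S + 1 := hω.lt_add_one hSD hτ.ge
    have h3 : M ω = m ω τ := by
      simp only [hM, hτ]
      exact iSup_apply_cap (m ω) τ
    have h0 : (0 : ℝ) ≤ τ := τ.2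
    rw [h3, hτ, ← ENNReal.ofReal_natCast, ← ENNReal.ofReal_coe_nnreal, ← ENNReal.ofReal_one,
      ← ENNReal.ofReal_add (by linarith) h0, ← ENNReal.ofReal_add (by linarith) (by norm_num)]
    exact ⟨ENNReal.ofReal_le_ofReal (by linarith),
      (ENNReal.ofReal_lt_ofReal_iff (by linarith)).2 (by linarith)⟩
  -- The overshoot above S. By `hM'` the truncated subtraction is almost surely exact, and `X < 1`
  -- almost surely gives a mean strictly below 1.
  set X : Ω → ℝ≥0∞ := fun ω => M ω - (ENNReal.ofReal (S - D) + e ω) with hX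
  have hmX : Measurable X := hmM.sub (measurable_const.add hme)
  have hX1 : ∫⁻ ω, X ω ∂μ < 1 := by
    have h : ∀ᵐ ω ∂μ, X ω < 1 := by
      filter_upwards [hM'] with ω hω
      exact ENNReal.sub_lt_of_lt_add hω.1 (by rw [add_comm]; exact hω.2)
    have hfin : ∫⁻ ω, X ω ∂μ ≠ ⊤ :=
      ne_top_of_le_ne_top (b := ∫⁻ _, (1 : ℝ≥0∞) ∂μ) (by simp)
        (lintegral_mono_ae (h.mono fun _ h => h.le))
    have := lintegral_strict_mono (IsProbabilityMeasure.ne_zero μ)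
      (measurable_const.aemeasurable (f := fun _ : Ω => (1 : ℝ≥0∞))) hfin h
    simpa using this
  have hsum : (R₀ + Rc : ℝ≥0) * ∫⁻ ω, e ω ∂μ =
      ENNReal.ofReal (S - D) + ∫⁻ ω, e ω ∂μ + ∫⁻ ω, X ω ∂μ := by
    have h1 : ∫⁻ ω, M ω ∂μ = ∫⁻ ω, ENNReal.ofReal (S - D) + e ω + X ω ∂μ :=
      lintegral_congr_ae (hM'.mono fun ω hω => (add_tsub_cancel_of_le hω.1).symm)
    rw [← hEM, h1, lintegral_add_right _ hmX, lintegral_add_left measurable_const]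
    simp
  refine ⟨hEfin, (∫⁻ ω, X ω ∂μ).toReal, ENNReal.toReal_nonneg, ?_, ?_⟩
  · rw [← ENNReal.toReal_one]
    exact (ENNReal.toReal_lt_toReal hX1.ne_top ENNReal.one_ne_top).2 hX1
  · have h := congrArg ENNReal.toReal hsum
    rw [ENNReal.toReal_mul, ENNReal.toReal_add (ENNReal.add_ne_top.2
      ⟨ENNReal.ofReal_ne_top, hEfin⟩) hX1.ne_top, ENNReal.toReal_add ENNReal.ofReal_ne_top hEfin,
      ENNReal.toReal_ofReal (by linarith), ENNReal.coe_toReal] at h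
    push_cast at h
    rw [one_div, eq_inv_mul_iff_mul_eq₀ hR'.ne']
    linarith

/-! ### Assembly. -/

theorem mainTheorem4 {Ω : Type*} [MeasurableSpace Ω] (μ : Measure Ω) [IsProbabilityMeasure μ]
    (R₀ Rc : ℝ≥0) (hR₀ : 1 < R₀) (hRc : 0 < Rc)
    (N Nc : Ω → CountingPath)
    (hN : IsPoissonProcess μ R₀ N) (hNc : IsPoissonProcess μ Rc Nc)
    (hind : IndepFun (fun ω t => N ω t) (fun ω t => Nc ω t) μ)
    (D ε : ℝ) (hDε : (D, ε) ∈ qoeRegion R₀ (R₀ + Rc))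
    (hε : Real.exp (-(rBar (R₀ + Rc) * D)) < ε) :
    -- the safe policies generate well-defined buffer and action paths
    (∀ (S : ℝ) (ω : Ω), ∃! p : (ℝ≥0 → ℝ) × (ℝ≥0 → Fin 2),
      IsClosedLoop (safePolicy S) D (N ω) (Nc ω) p.1 p.2) ∧
    -- feasibility
    (∀ S : ℝ, safeThreshold R₀ (R₀ + Rc) D ε ≤ S → IsFeasible μ N Nc ⊤ (safePolicy S) D ε) ∧
    -- the minimal cost over the thresholds `S ≥ S*` is attained at `S*`
    IsLeast ((fun S : ℝ => usageCost μ N Nc ⊤ (safePolicy S) D ε) ''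
        Set.Ici (safeThreshold R₀ (R₀ + Rc) D ε))
      (usageCost μ N Nc ⊤ (safePolicy (safeThreshold R₀ (R₀ + Rc) D ε)) D ε) ∧
    -- its value
    (usageCost μ N Nc ⊤ (safePolicy (safeThreshold R₀ (R₀ + Rc) D ε)) D ε ≠ ⊤ ∧
      ∃ ξ : ℝ, 0 ≤ ξ ∧ ξ < 1 ∧
        (usageCost μ N Nc ⊤ (safePolicy (safeThreshold R₀ (R₀ + Rc) D ε)) D ε).toReal =
          1 / ((R₀ : ℝ) + Rc - 1) * (safeThreshold R₀ (R₀ + Rc) D ε - D + ξ)) := by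
  have hR₀' : (1 : ℝ) < R₀ := hR₀
  have hRc' : (0 : ℝ) < Rc := hRc
  have hR₁ : (1 : ℝ) < R₀ + Rc := by linarith
  obtain ⟨hε0, -, hD⟩ := hDε
  simp only at hε0 hD
  set α₀ := rBar R₀ with hα₀
  set α₁ := rBar (R₀ + Rc) with hα₁
  set S₀ := safeThreshold R₀ (R₀ + Rc) D ε with hS₀
  have h₀ : 0 < α₀ := rBar_pos hR₀'
  have h₁ : 0 < α₁ := rBar_pos hR₁
  have hr₀ : α₀ + R₀ * (Real.exp (-α₀) - 1) = 0 := rBar_root (by linarith)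
  have hr₁ : α₁ + (R₀ + Rc : ℝ≥0) * (Real.exp (-α₁) - 1) = 0 := by
    push_cast
    exact rBar_root (by linarith)
  have hpos : 0 < ε - Real.exp (-(α₁ * D)) := sub_pos.2 hε
  have hαS : α₀ * S₀ = -Real.log (ε - Real.exp (-(α₁ * D))) := by
    rw [hS₀, safeThreshold, ← hα₀, ← hα₁, one_div (ε - _), Real.log_inv, ← mul_assoc,
      mul_one_div_cancel h₀.ne', one_mul]
  -- D is at most log(1/ε)/α₀, and subtracting exp(-α₁D) > 0 from ε strictly raises this value to
  -- S*.
  have hDS : D < S₀ := by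
    have h2 : Real.log (ε - Real.exp (-(α₁ * D))) < Real.log ε :=
      Real.log_lt_log hpos (by linarith [Real.exp_pos (-(α₁ * D))])
    rw [one_div ε, Real.log_inv, one_div, le_inv_mul_iff₀ h₀] at hD
    exact lt_of_mul_lt_mul_left (by linarith) h₀.le
  have hfeas : ∀ S : ℝ, S₀ ≤ S → IsFeasible μ N Nc ⊤ (safePolicy S) D ε := by
    intro S hS
    rw [IsFeasible, interruptionProb_top_safePolicy]
    refine (hN.measure_exists_safeBuffer_le hNc hind h₀.le h₁.le hr₀ hr₁ S D).trans
      (ENNReal.ofReal_le_ofReal ?_)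
    -- S* is the solution of exp(-α₀S) = ε - exp(-α₁D).
    have h2 : Real.exp (-(α₀ * S)) ≤ ε - Real.exp (-(α₁ * D)) := by
      rw [← Real.le_log_iff_exp_le hpos]
      have := mul_le_mul_of_nonneg_left hS h₀.le
      linarith
    linarith
  refine ⟨fun S ω => existsUnique_isClosedLoop_safePolicy S D (N ω) (Nc ω), hfeas,
    ⟨⟨S₀, Set.mem_Ici.2 le_rfl, rfl⟩, ?_⟩, ?_⟩
  · rintro _ ⟨S, hS, rfl⟩
    simp only
    rw [usageCost_top_safePolicy (hfeas S₀ le_rfl), usageCost_top_safePolicy (hfeas S hS)]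
    exact lintegral_mono fun ω => exitTime_mono _ D hS
  · rw [usageCost_top_safePolicy (hfeas S₀ le_rfl)]
    exact hN.exists_lintegral_exitTime_eq hNc hind hR₁ hDS
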